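/- Let $\mathcal H$ be a complex Hilbert space. A linear relation in $\mathcal H$ is a linear subspace $A\subseteq\mathcal H\times\mathcal H$; it is nonnegative selfadjoint if $A^*=A$ and $(f',f)\ge 0$ for all $\{f,f'\}\in A$. Write $\operatorname{mul}A=\{f':\{0,f'\}\in A\}$, $\operatorname{ran}A=\{f':\{f,f'\}\in A\}$, $A^{-1}=\{\{f',f\}:\{f,f'\}\in A\}$, $\lambda A=\{\{f,\lambda f'\}:\{f,f'\}\in A\}$ and $A+B=\{\{f,f'+g'\}:\{f,f'\}\in A,\ \{f,g'\}\in B\}$. For nonnegative selfadjoint $A$ let $A_o=\{\{f,f'\}\in A: f'\perp\operatorname{mul}A\}$ be its operator part, let $A_o^{1/2}$ be the nonnegative selfadjoint square root of $A_o$ in $\mathcal H\ominus\operatorname{mul}A$, and put $A^{1/2}=A_o^{1/2}\oplus(\{0\}\oplus\operatorname{mul}A)$. Let $A[f,g]=(A_o^{1/2}f,A_o^{1/2}g)$ be the closed form with domain $\mathcal D[A]=\operatorname{dom}A_o^{1/2}$, and $A[f]=A[f,f]$. Write $A\le B$ if $\mathcal D[B]\subseteq\mathcal D[A]$ and $\|A_o^{1/2}f\|\le\|B_o^{1/2}f\|$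 for all $f\in\mathcal D[B]$. The form sum $A\dot+B$ (respectively $A\dot+B\dot+C$) is the nonnegative selfadjoint relation associated with the closed form $A[\cdot,\cdot]+B[\cdot,\cdot]$ on $\mathcal D[A]\cap\mathcal D[B]$ (respectively $A[\cdot,\cdot]+B[\cdot,\cdot]+C[\cdot,\cdot]$ on $\mathcal D[A]\cap\mathcal D[B]\cap\mathcal D[C]$), where the relation associated with a form $\mathfrak a$ is $\{\{f,f'\}: f\in\operatorname{dom}\mathfrak a,\ \mathfrak a[f,\psi]=(f',\psi)\ \forall\psi\in\operatorname{dom}\mathfrak a\}$. The parallel sum is $A:B=(A^{-1}\dot+B^{-1})^{-1}$ and the harmonic mean is $h(A,B)=2(A:B)$. A sequence $A_n$ of nonnegative selfadjoint relations converges to a nonnegative selfadjoint relation $A$ in the strong resolvent sense ($A=\text{s-R-}\lim A_n$) if the bounded operators $(A_n+I)^{-1}$ converge strongly to $(A+I)^{-1}$. Let $A,B,C,A_1,A_2$ be nonnegative selfadjoint linear relations in $\mathcal H$. Then $A:B$ is a nonnegative selfadjoint linear relation, and: 1. $\lambda A:\lambda B=\lambda(A:B)$ for every $\lambda>0$; 2.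 $A:B=B:A$; 3. $(A:B):C=A:(B:C)=(A^{-1}\dot+B^{-1}\dot+C^{-1})^{-1}$; 4. $A:B\le A$ and $A:B\le B$; 5. if $A_1\le A_2$, then $A_1:B\le A_2:B$; 6. $\operatorname{ran}(A:B)^{1/2}=\operatorname{ran}A^{1/2}\cap\operatorname{ran}B^{1/2}$; 7. $A:B=0$ (the zero operator with domain $\mathcal H$) if and only if $\operatorname{ran}A^{1/2}\cap\operatorname{ran}B^{1/2}=\{0\}$; 8. if the quadratic form $A^{-1}[\cdot]$ is a restriction of the quadratic form $B^{-1}[\cdot]$ (that is, $\mathcal D[A^{-1}]\subseteq\mathcal D[B^{-1}]$ and $A^{-1}[f]=B^{-1}[f]$ for $f\in\mathcal D[A^{-1}]$), then $h(A,B)=A$. Moreover, $$A:B=\text{s-R-}\lim_{n\to\infty}\Bigl(\bigl(A+\tfrac1n I\bigr):\bigl(B+\tfrac1n I\bigr)\Bigr)=\text{s-R-}\lim_{n\to\infty}\Bigl(\bigl(A+\tfrac1n I\bigr)^{-1}+\bigl(B+\tfrac1n I\bigr)^{-1}\Bigr)^{-1},$$ where all the relations in these sequences ($n\ge1$) are nonnegative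 selfadjoint. -/

import Mathlib

/-- A (not necessarily closed) linear relation in the complex Hilbert space `H`: a linear manifold
in `H × H`. Closedness comes from selfadjointness, see `LinRel.IsNonnegSelfAdjoint`. -/
abbrev LinRel (H : Type*) [NormedAddCommGroup H] [InnerProductSpace ℂ H] : Type _ :=
  Submodule ℂ (H × H)

/-- A sesquilinear form `a[·,·]` with domain `dom` in `H`; `toFun ψ φ` is `a[φ, ψ]`
(Mathlib's inner product is conjugate-linear in its first argument). -/
structure SesqForm (H : Type*) [NormedAddCommGroup H] [InnerProductSpace ℂ H] where
  dom : Submodule ℂ H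
  toFun : dom →ₗ⋆[ℂ] dom →ₗ[ℂ] ℂ

namespace SesqForm

variable {H : Type*} [NormedAddCommGroup H] [InnerProductSpace ℂ H]

/-- The sum `a[φ, ψ] + b[φ, ψ]`, with domain `dom a ∩ dom b`. -/
def add (a b : SesqForm H) : SesqForm H where
  dom := a.dom ⊓ b.dom
  toFun := LinearMap.mk₂'ₛₗ (starRingEnd ℂ) (RingHom.id ℂ)
    (fun ψ φ =>
      a.toFun (Submodule.inclusion inf_le_left ψ) (Submodule.inclusion inf_le_left φ) +
        b.toFun (Submodule.inclusion inf_le_right ψ) (Submodule.inclusion inf_le_right φ))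
    (fun _ _ _ => by simp only [map_add, LinearMap.add_apply]; ring)
    (fun _ _ _ => by
      simp only [map_smul, LinearMap.map_smulₛₗ, LinearMap.smul_apply, smul_add])
    (fun _ _ _ => by simp only [map_add]; ring)
    (fun _ _ _ => by simp only [map_smul, smul_add, RingHom.id_apply])

/-- The linear relation associated with a form `a`: all pairs `(f, f')` with `f ∈ dom a` and
`a[f, ψ] = (f', ψ)` for all `ψ ∈ dom a`. For a closed nonnegative form it is the nonnegative
selfadjoint relation of the first representation theorem. -/
def toRel (a : SesqForm H) : LinRel H where
  carrier := {p | ∃ hf : p.1 ∈ a.dom, ∀ ψ : a.dom, a.toFun ψ ⟨p.1, hf⟩ = inner ℂ (ψ : H) p.2}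
  zero_mem' := ⟨a.dom.zero_mem, fun ψ => by
    rw [Prod.snd_zero, inner_zero_right]
    exact (a.toFun ψ).map_zero⟩
  add_mem' := by
    rintro p q ⟨hp, hp'⟩ ⟨hq, hq'⟩
    refine ⟨a.dom.add_mem hp hq, fun ψ => ?_⟩
    have h := (a.toFun ψ).map_add ⟨p.1, hp⟩ ⟨q.1, hq⟩
    rw [hp', hq'] at h
    rw [Prod.snd_add, inner_add_right]
    exact h
  smul_mem' := by
    rintro c p ⟨hp, hp'⟩
    refine ⟨a.dom.smul_mem c hp, fun ψ => ?_⟩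
    have h := (a.toFun ψ).map_smul c ⟨p.1, hp⟩
    rw [hp'] at h
    rw [Prod.smul_snd, inner_smul_right]
    exact h

/-- The quadratic form `a[·]` is a restriction of the quadratic form `b[·]`. -/
def IsRestrictionOf (a b : SesqForm H) : Prop :=
  ∃ h : a.dom ≤ b.dom, ∀ φ : a.dom,
    a.toFun φ φ = b.toFun (Submodule.inclusion h φ) (Submodule.inclusion h φ)

end SesqForm

namespace LinRel

variable {H : Type*} [NormedAddCommGroup H] [InnerProductSpace ℂ H]

/-- The range `{f' | ∃ f, (f, f') ∈ A}`. -/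
def ran (A : LinRel H) : Submodule ℂ H := A.map (LinearMap.snd ℂ H H)

/-- The multivalued part `{f' | (0, f') ∈ A}`. -/
def mulPart (A : LinRel H) : Submodule ℂ H := A.comap (LinearMap.inr ℂ H H)

/-- The inverse `{(f', f) | (f, f') ∈ A}`. -/
def inv (A : LinRel H) : LinRel H := A.comap (LinearEquiv.prodComm ℂ H H).toLinearMap

/-- The multiple `c A = {(f, c f') | (f, f') ∈ A}` by a real number `c`. -/
def scale (c : ℝ) (A : LinRel H) : LinRel H :=
  A.map (LinearMap.prodMap LinearMap.id ((c : ℂ) • LinearMap.id))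

/-- The sum `{(f, f' + g') | (f, f') ∈ A, (f, g') ∈ B}`. -/
def add (A B : LinRel H) : LinRel H where
  carrier := {p | ∃ f' g' : H, (p.1, f') ∈ A ∧ (p.1, g') ∈ B ∧ p.2 = f' + g'}
  zero_mem' := ⟨0, 0, A.zero_mem, B.zero_mem, by simp⟩
  add_mem' := by
    rintro p q ⟨f, g, hf, hg, h⟩ ⟨u, v, hu, hv, k⟩
    exact ⟨f + u, g + v, A.add_mem hf hu, B.add_mem hg hv, by
      rw [Prod.snd_add, h, k]; abel⟩
  smul_mem' := by
    rintro c p ⟨f, g, hf, hg, h⟩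
    exact ⟨c • f, c • g, A.smul_mem c hf, B.smul_mem c hg, by
      rw [Prod.smul_snd, h, smul_add]⟩

/-- The product (composition) `A B = {(f, h) | ∃ g, (f, g) ∈ B, (g, h) ∈ A}`. -/
def comp (A B : LinRel H) : LinRel H where
  carrier := {p | ∃ g : H, (p.1, g) ∈ B ∧ (g, p.2) ∈ A}
  zero_mem' := ⟨0, B.zero_mem, A.zero_mem⟩
  add_mem' := by
    rintro p q ⟨g, hg, hg'⟩ ⟨k, hk, hk'⟩
    exact ⟨g + k, B.add_mem hg hk, A.add_mem hg' hk'⟩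
  smul_mem' := by
    rintro c p ⟨g, hg, hg'⟩
    exact ⟨c • g, B.smul_mem c hg, A.smul_mem c hg'⟩

/-- The graph of the identity operator `I`. -/
def idRel : LinRel H := (LinearMap.id : H →ₗ[ℂ] H).graph

/-- The graph of the everywhere defined zero operator. -/
def zeroRel : LinRel H := (0 : H →ₗ[ℂ] H).graph

/-- `A` is selfadjoint (`A* = A`) and `(f', f) ≥ 0` for all `(f, f') ∈ A`. The inner product in
question is automatically real, by selfadjointness. -/
structure IsNonnegSelfAdjoint (A : LinRel H) : Prop where
  selfAdjoint : Submodule.adjoint A = A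
  nonneg : ∀ p ∈ A, 0 ≤ (inner ℂ p.1 p.2).re

/-- The (graph of the) operator part `A_o = {(f, f') ∈ A | f' ⊥ mul A}`, so that
`A = A_o ⊕ ({0} ⊕ mul A)`. -/
noncomputable def opPart (A : LinRel H) : LinRel H :=
  A ⊓ (⊤ : Submodule ℂ H).prod A.mulPartᗮ

/-- `S` is the nonnegative selfadjoint square root of `A`, that is
`S = A_o^{1/2} ⊕ ({0} ⊕ mul A)`: the multivalued parts agree, and the operator part of `S` is a
nonnegative selfadjoint square root of the operator part of `A`. -/
structure IsSqrt (A S : LinRel H) : Prop where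
  nonnegSelfAdjoint : IsNonnegSelfAdjoint S
  mulPart_eq : S.mulPart = A.mulPart
  opPart_comp : S.opPart.comp S.opPart = A.opPart

open Classical in
/-- The square root `A^{1/2}` of a nonnegative selfadjoint relation `A`, i.e. the (unique) relation
`S` with `IsSqrt A S`. (Junk value `⊥` if there is none.) -/
noncomputable def sqrt (A : LinRel H) : LinRel H :=
  if h : ∃ S : LinRel H, IsSqrt A S then h.choose else ⊥

/-- The operator `A_o^{1/2}`, the operator part of `A^{1/2}`, as a partially defined operator. -/
noncomputable def sqrtOp (A : LinRel H) : H →ₗ.[ℂ] H := A.sqrt.opPart.toLinearPMap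

/-- The closed form `A[φ, ψ] = (A_o^{1/2} φ, A_o^{1/2} ψ)` associated with `A`, with domain
`D[A] = dom A_o^{1/2}`. -/
noncomputable def form (A : LinRel H) : SesqForm H where
  dom := A.sqrtOp.domain
  toFun := LinearMap.mk₂'ₛₗ (starRingEnd ℂ) (RingHom.id ℂ)
    (fun ψ φ => inner ℂ (A.sqrtOp ψ) (A.sqrtOp φ))
    (fun _ _ _ => by rw [LinearPMap.map_add, inner_add_left])
    (fun _ _ _ => by rw [LinearPMap.map_smul, inner_smul_left, smul_eq_mul])
    (fun _ _ _ => by rw [LinearPMap.map_add, inner_add_right])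
    (fun _ _ _ => by rw [LinearPMap.map_smul, inner_smul_right, RingHom.id_apply, smul_eq_mul])

/-- The inequality `A ≤ B` of nonnegative selfadjoint relations:
`dom B_o^{1/2} ⊆ dom A_o^{1/2}` and `‖A_o^{1/2} φ‖ ≤ ‖B_o^{1/2} φ‖` for `φ ∈ dom B_o^{1/2}`. -/
def FormLE (A B : LinRel H) : Prop :=
  ∃ h : B.sqrtOp.domain ≤ A.sqrtOp.domain, ∀ φ : B.sqrtOp.domain,
    ‖A.sqrtOp (Submodule.inclusion h φ)‖ ≤ ‖B.sqrtOp φ‖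

/-- The form sum `A ∔ B`: the relation associated with the form `A[·,·] + B[·,·]` on
`D[A] ∩ D[B]`. -/
noncomputable def formSum (A B : LinRel H) : LinRel H := (A.form.add B.form).toRel

/-- The form sum `A ∔ B ∔ C` of three relations: the relation associated with the form
`A[·,·] + B[·,·] + C[·,·]` on `D[A] ∩ D[B] ∩ D[C]`. -/
noncomputable def formSum₃ (A B C : LinRel H) : LinRel H :=
  ((A.form.add B.form).add C.form).toRel

/-- The parallel sum `A : B = (A⁻¹ ∔ B⁻¹)⁻¹`. -/
noncomputable def parallelSum (A B : LinRel H) : LinRel H := (A.inv.formSum B.inv).inv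

/-- The harmonic mean `h(A, B) = 2 (A : B)`. -/
noncomputable def harmonicMean (A B : LinRel H) : LinRel H := (A.parallelSum B).scale 2

/-- The relation `A + c I`. -/
def addScalar (A : LinRel H) (c : ℝ) : LinRel H := A.add (idRel.scale c)

/-- The sequence `A n` of nonnegative selfadjoint relations converges to the nonnegative
selfadjoint relation `A` in the strong resolvent sense: `(A n + I)⁻¹` and `(A + I)⁻¹` are (graphs
of) everywhere defined bounded operators, and `(A n + I)⁻¹ f → (A + I)⁻¹ f` for all `f`. -/
def IsStrongResolventLimit (A : ℕ → LinRel H) (A' : LinRel H) : Prop :=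
  (∀ n, IsNonnegSelfAdjoint (A n)) ∧ IsNonnegSelfAdjoint A' ∧
    ∃ (R : ℕ → H →L[ℂ] H) (R' : H →L[ℂ] H),
      (∀ n, ((A n).addScalar 1).inv = (R n : H →ₗ[ℂ] H).graph) ∧
      (A'.addScalar 1).inv = (R' : H →ₗ[ℂ] H).graph ∧
      ∀ f : H, Filter.Tendsto (fun n => R n f) Filter.atTop (nhds (R' f))

end LinRel

/-! Everything is transported to bounded operators. A nonnegative selfadjoint relation `A` is the
set of pairs `(R h, h - R h)`, where `R = (A + I)⁻¹` satisfies `0 ≤ R ≤ 1`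
(`exists_eq_ofResolvent`). Inversion becomes `R ↦ 1 - R`, and `A^{1/2}` becomes the set of pairs
`(R^{1/2} h, (1 - R)^{1/2} h)`. Hence `ran A^{1/2}` is the form domain of `A⁻¹`.

The form of `A` is recovered from `R` variationally: `u` lies in the domain with `A[u] + ‖u‖² ≤ c`
iff `|(u, x)|² ≤ c (x, R x)` for all `x`. So `A ≤ B` iff the resolvents are ordered in reverse
(`formLE_ofResolvent_iff`), and inversion is antitone.

A sum of two closed forms is closed, so the form of `A ∔ B` is exactly the sum of the forms
(`formSum_spec`). Every algebraic claim about `A : B` then becomes an elementary statement about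
sums of forms, conjugated by inversion.

For the limit, the forms of `(A + εI)⁻¹` and `(B + εI)⁻¹` increase as `ε` decreases to `0`. The
resolvents of the form sums therefore decrease to a strong limit. Monotonicity bounds this limit
below, and lower semicontinuity of the forms bounds it above, by the resolvent of `A⁻¹ ∔ B⁻¹`
(`tendsto_formSum`). For `ε > 0` the inverses are everywhere defined, so the ordinary sum is the
form sum. -/

open scoped InnerProduct
open Filter Topology

/-! ### Linear relations parametrized by bounded operators -/

namespace LinRel

section Basic

variable {H : Type*} [NormedAddCommGroup H] [InnerProductSpace ℂ H]

theorem IsNonnegSelfAdjoint.mem_iff {A : LinRel H} (hA : A.IsNonnegSelfAdjoint) (p : H × H) :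
    p ∈ A ↔ ∀ q ∈ A, inner ℂ q.2 p.1 = inner ℂ q.1 p.2 := by
  conv_lhs => rw [← hA.selfAdjoint]
  rw [Submodule.mem_adjoint_iff]
  exact ⟨fun h q hq => sub_eq_zero.1 (h q.1 q.2 hq), fun h a b hab => sub_eq_zero.2 (h (a, b) hab)⟩

theorem isNonnegSelfAdjoint_of_mem_iff {A : LinRel H}
    (h : ∀ p : H × H, p ∈ A ↔ ∀ q ∈ A, inner ℂ q.2 p.1 = inner ℂ q.1 p.2)
    (hnonneg : ∀ p ∈ A, 0 ≤ (inner ℂ p.1 p.2).re) : A.IsNonnegSelfAdjoint where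
  selfAdjoint := by
    ext p
    rw [Submodule.mem_adjoint_iff, h p]
    exact ⟨fun h q hq => sub_eq_zero.1 (h q.1 q.2 hq),
      fun h a b hab => sub_eq_zero.2 (h (a, b) hab)⟩
  nonneg := hnonneg

/-- Selfadjoint relations are maximal: `A ≤ B` gives `B = B* ≤ A* = A`. Later equalities of
relations thus need only one inclusion. -/
theorem IsNonnegSelfAdjoint.eq_of_le {A B : LinRel H} (hA : A.IsNonnegSelfAdjoint)
    (hB : B.IsNonnegSelfAdjoint) (h : A ≤ B) : A = B := by
  refine le_antisymm h fun p hp => (hA.mem_iff p).2 fun q hq => (hB.mem_iff p).1 hp q (h hq)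

theorem IsNonnegSelfAdjoint.isClosed {A : LinRel H} (hA : A.IsNonnegSelfAdjoint) :
    IsClosed (A : Set (H × H)) := by
  have : (A : Set (H × H)) = ⋂ q ∈ A, {p : H × H | inner ℂ q.2 p.1 = inner ℂ q.1 p.2} := by
    ext p
    simpa using hA.mem_iff p
  rw [this]
  exact isClosed_biInter fun q _ => isClosed_eq (by fun_prop) (by fun_prop)

theorem IsNonnegSelfAdjoint.isClosed_mulPart {A : LinRel H} (hA : A.IsNonnegSelfAdjoint) :
    IsClosed (A.mulPart : Set H) :=
  hA.isClosed.preimage (f := fun x : H => ((0 : H), x)) (by fun_prop)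

theorem IsNonnegSelfAdjoint.inner_eq_zero_of_mem_mulPart {A : LinRel H}
    (hA : A.IsNonnegSelfAdjoint) {p : H × H} (hp : p ∈ A) {m : H} (hm : m ∈ A.mulPart) :
    inner ℂ m p.1 = 0 := by
  have := (hA.mem_iff p).1 hp (0, m) hm
  simpa using this

theorem IsNonnegSelfAdjoint.norm_sq_le {A : LinRel H} (hA : A.IsNonnegSelfAdjoint) {p : H × H}
    (hp : p ∈ A) : ‖p.1‖ ^ 2 + ‖p.2‖ ^ 2 ≤ ‖p.1 + p.2‖ ^ 2 := by
  have h := @norm_add_sq ℂ H _ _ _ p.1 p.2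
  have := hA.nonneg p hp
  rw [h]
  change _ ≤ _ + 2 * (inner ℂ p.1 p.2).re + _
  linarith

theorem mem_inv {A : LinRel H} {p : H × H} : p ∈ A.inv ↔ (p.2, p.1) ∈ A := Iff.rfl

theorem inv_inv (A : LinRel H) : A.inv.inv = A := rfl

/-- The relation `{(C h, S h) | h ∈ H}` parametrized by a pair of bounded operators. -/
def ofPair (C S : H →L[ℂ] H) : LinRel H :=
  LinearMap.range ((C : H →ₗ[ℂ] H).prod (S : H →ₗ[ℂ] H))

theorem mem_ofPair {C S : H →L[ℂ] H} {p : H × H} :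
    p ∈ ofPair C S ↔ ∃ h, C h = p.1 ∧ S h = p.2 := by
  simp [ofPair, Prod.ext_iff]

theorem inv_ofPair (C S : H →L[ℂ] H) : (ofPair C S).inv = ofPair S C := by
  ext p
  simp only [mem_inv, mem_ofPair, and_comm]

/-- The relation `A` whose resolvent `(A + I)⁻¹` is `R`. -/
def ofResolvent (R : H →L[ℂ] H) : LinRel H := ofPair R (1 - R)

theorem mem_ofResolvent {R : H →L[ℂ] H} {p : H × H} :
    p ∈ ofResolvent R ↔ p.1 = R (p.1 + p.2) := by
  rw [ofResolvent, mem_ofPair]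
  constructor
  · rintro ⟨h, h1, h2⟩
    rw [← h1, ← h2]
    simp
  · intro h
    refine ⟨p.1 + p.2, h.symm, ?_⟩
    simp [← h]

theorem ofResolvent_injective {R R' : H →L[ℂ] H} (h : ofResolvent R = ofResolvent R') :
    R = R' := by
  ext x
  have : ((R x, x - R x) : H × H) ∈ ofResolvent R := by simp [mem_ofResolvent]
  rw [h, mem_ofResolvent] at this
  simpa using this

theorem inv_ofResolvent (R : H →L[ℂ] H) : (ofResolvent R).inv = ofResolvent (1 - R) := by
  rw [ofResolvent, inv_ofPair, ofResolvent, sub_sub_cancel]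

theorem mem_addScalar {A : LinRel H} {c : ℝ} {p : H × H} :
    p ∈ A.addScalar c ↔ (p.1, p.2 - (c : ℂ) • p.1) ∈ A := by
  constructor
  · rintro ⟨f', g', hf, hg, h⟩
    obtain ⟨⟨a, b⟩, hab, hab'⟩ := hg
    simp only [idRel, SetLike.mem_coe, LinearMap.mem_graph_iff, LinearMap.id_coe, id_eq] at hab
    simp only [LinearMap.prodMap_apply, LinearMap.id_coe, id_eq, LinearMap.smul_apply,
      Prod.mk.injEq] at hab'
    rw [h, ← hab'.2, hab, hab'.1]
    simpa using hf
  · intro h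
    refine ⟨_, (c : ℂ) • p.1, h, ⟨(p.1, p.1), by simp [idRel], by simp⟩, by simp⟩

theorem inv_addScalar_one_ofResolvent (R : H →L[ℂ] H) :
    ((ofResolvent R).addScalar 1).inv = (R : H →ₗ[ℂ] H).graph := by
  ext p
  simp [mem_inv, mem_addScalar, mem_ofResolvent]

theorem mem_scale {A : LinRel H} {c : ℝ} {p : H × H} :
    p ∈ A.scale c ↔ ∃ g, (p.1, g) ∈ A ∧ (c : ℂ) • g = p.2 := by
  constructor
  · rintro ⟨⟨a, b⟩, hab, h⟩
    simp only [LinearMap.prodMap_apply, LinearMap.id_coe, id_eq, LinearMap.smul_apply] at h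
    exact ⟨b, by rw [← h]; exact hab, by rw [← h]⟩
  · rintro ⟨g, hg, h⟩
    exact ⟨(p.1, g), hg, Prod.ext rfl h⟩

theorem mem_scale_iff {A : LinRel H} {c : ℝ} (hc : c ≠ 0) {p : H × H} :
    p ∈ A.scale c ↔ (p.1, ((c⁻¹ : ℝ) : ℂ) • p.2) ∈ A := by
  have hc' : (c : ℂ) ≠ 0 := by exact_mod_cast hc
  rw [mem_scale]
  constructor
  · rintro ⟨g, hg, h⟩
    rwa [← h, smul_smul, Complex.ofReal_inv, inv_mul_cancel₀ hc', one_smul]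
  · intro h
    exact ⟨_, h, by rw [smul_smul, Complex.ofReal_inv, mul_inv_cancel₀ hc', one_smul]⟩

theorem scale_scale {A : LinRel H} {c d : ℝ} (hc : c ≠ 0) (hd : d ≠ 0) :
    (A.scale c).scale d = A.scale (d * c) := by
  ext p
  rw [mem_scale_iff hd, mem_scale_iff hc, mem_scale_iff (mul_ne_zero hd hc), smul_smul, mul_inv,
    mul_comm d⁻¹]
  push_cast
  rfl

theorem scale_one (A : LinRel H) : A.scale 1 = A := by
  ext p
  simp [mem_scale_iff one_ne_zero]

theorem inv_scale {A : LinRel H} {c : ℝ} (hc : c ≠ 0) : (A.scale c).inv = A.inv.scale c⁻¹ := by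
  have hc' : (c : ℂ) ≠ 0 := by exact_mod_cast hc
  ext p
  rw [mem_inv, mem_scale_iff hc, mem_scale_iff (inv_ne_zero hc), mem_inv]
  rw [← A.smul_mem_iff hc']
  simp [smul_smul, hc']

theorem zeroRel_eq_ofResolvent : (zeroRel : LinRel H) = ofResolvent 1 := by
  ext p
  simp [zeroRel, mem_ofResolvent]

end Basic

/-! ### Nonnegative selfadjoint relations and their resolvents -/

section Complete

variable {H : Type*} [NormedAddCommGroup H] [InnerProductSpace ℂ H] [CompleteSpace H]

/-- A pair `p` in the adjoint satisfies `C p.2 = S p.1`, and the Bézout identity then produces its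
parameter `U p.1 + V p.2`. This serves both the resolvent, with `C = R`, `S = 1 - R`, `U = V = 1`,
and the square root, with `C = U = R^{1/2}` and `S = V = (1 - R)^{1/2}`. -/
theorem isNonnegSelfAdjoint_ofPair {C S U V : H →L[ℂ] H} (hC : IsSelfAdjoint C)
    (hS : IsSelfAdjoint S) (hCS : Commute C S) (hnonneg : 0 ≤ C * S) (hUC : Commute U C)
    (hVC : Commute V C) (hUS : Commute U S) (hVS : Commute V S) (h1 : U * C + V * S = 1) :
    (ofPair C S).IsNonnegSelfAdjoint := by
  have hsC := ContinuousLinearMap.isSelfAdjoint_iff_isSymmetric.1 hC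
  have hsS := ContinuousLinearMap.isSelfAdjoint_iff_isSymmetric.1 hS
  have app {X Y : H →L[ℂ] H} (h : Commute X Y) (x : H) : X (Y x) = Y (X x) :=
    congrArg (fun T : H →L[ℂ] H => T x) h.eq
  have hone (x : H) : U (C x) + V (S x) = x := congrArg (fun T : H →L[ℂ] H => T x) h1
  refine isNonnegSelfAdjoint_of_mem_iff (fun p => ⟨?_, ?_⟩) ?_
  · intro hp q hq
    obtain ⟨x, hx1, hx2⟩ := mem_ofPair.1 hp
    obtain ⟨y, hy1, hy2⟩ := mem_ofPair.1 hq
    rw [← hx1, ← hx2, ← hy1, ← hy2]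
    have h1 : inner ℂ (S y) (C x) = inner ℂ y (S (C x)) := hsS y (C x)
    have h2 : inner ℂ (C y) (S x) = inner ℂ y (C (S x)) := hsC y (S x)
    rw [h1, h2, app hCS]
  · intro h
    have key : C p.2 = S p.1 := by
      refine ext_inner_left ℂ fun y => ?_
      have := h (C y, S y) (mem_ofPair.2 ⟨y, rfl, rfl⟩)
      have h1 : inner ℂ (S y) p.1 = inner ℂ y (S p.1) := hsS y _
      have h2 : inner ℂ (C y) p.2 = inner ℂ y (C p.2) := hsC y _
      rw [← h1, ← h2, this]
    refine mem_ofPair.2 ⟨U p.1 + V p.2, ?_, ?_⟩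
    · rw [map_add, ← app hUC, ← app hVC, key, hone]
    · rw [map_add, ← app hUS, ← app hVS, ← key, hone]
  · intro p hp
    obtain ⟨x, hx1, hx2⟩ := mem_ofPair.1 hp
    rw [← hx1, ← hx2]
    have h2 : inner ℂ (C x) (S x) = inner ℂ x ((C * S) x) := hsC x (S x)
    rw [h2]
    exact ((ContinuousLinearMap.nonneg_iff_isPositive _).1 hnonneg).re_inner_nonneg_right x

theorem isNonnegSelfAdjoint_ofResolvent {R : H →L[ℂ] H} (h0 : 0 ≤ R) (h1 : R ≤ 1) :
    (ofResolvent R).IsNonnegSelfAdjoint := by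
  have hc : Commute R (1 - R) := (Commute.one_right R).sub_right (Commute.refl R)
  exact isNonnegSelfAdjoint_ofPair (U := 1) (V := 1) (IsSelfAdjoint.of_nonneg h0)
    (IsSelfAdjoint.of_nonneg (sub_nonneg.2 h1)) hc (hc.mul_nonneg h0 (sub_nonneg.2 h1))
    (Commute.one_left _) (Commute.one_left _) (Commute.one_left _) (Commute.one_left _) (by simp)

/-- Nonnegativity makes `(f, f') ↦ f + f'` bounded below on the closed space `A`, so its range is
closed. A vector `g` orthogonal to the range gives `(g, -g) ∈ A* = A`, whence `-‖g‖² ≥ 0` and `g =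
0`. The map is thus bijective, and `R` is the first component of its inverse. -/
theorem IsNonnegSelfAdjoint.exists_eq_ofResolvent {A : LinRel H} (hA : A.IsNonnegSelfAdjoint) :
    ∃ R : H →L[ℂ] H, 0 ≤ R ∧ R ≤ 1 ∧ A = ofResolvent R := by
  let σ : A →L[ℂ] H := (ContinuousLinearMap.fst ℂ H H + ContinuousLinearMap.snd ℂ H H).comp
    A.subtypeL
  have hσ (p : A) : σ p = p.1.1 + p.1.2 := rfl
  have hnorm1 (p : A) : ‖p.1.1‖ ≤ ‖σ p‖ := by
    have := hA.norm_sq_le p.2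
    rw [hσ]
    nlinarith [norm_nonneg p.1.1, norm_nonneg p.1.2, norm_nonneg (p.1.1 + p.1.2)]
  have hnorm2 (p : A) : ‖p.1.2‖ ≤ ‖σ p‖ := by
    have := hA.norm_sq_le p.2
    rw [hσ]
    nlinarith [norm_nonneg p.1.1, norm_nonneg p.1.2, norm_nonneg (p.1.1 + p.1.2)]
  have hanti : AntilipschitzWith 1 σ := by
    refine σ.antilipschitz_of_bound fun p => ?_
    rw [NNReal.coe_one, one_mul]
    exact max_le (hnorm1 p) (hnorm2 p)
  have : CompleteSpace A := hA.isClosed.completeSpace_coe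
  have hclosed : IsClosed (LinearMap.range (σ : A →ₗ[ℂ] H) : Set H) :=
    hanti.isClosed_range σ.uniformContinuous
  have htop : LinearMap.range (σ : A →ₗ[ℂ] H) = ⊤ := by
    rw [← hclosed.submodule_topologicalClosure_eq, Submodule.topologicalClosure_eq_top_iff,
      Submodule.eq_bot_iff]
    intro g hg
    have hmem : ((g, -g) : H × H) ∈ A := by
      refine (hA.mem_iff _).2 fun q hq => ?_
      have := (Submodule.mem_orthogonal _ _).1 hg (σ ⟨q, hq⟩) ⟨_, rfl⟩
      rw [hσ, inner_add_left] at this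
      rw [inner_neg_right]
      linear_combination this
    have h := hA.nonneg _ hmem
    rw [inner_neg_right, inner_self_eq_norm_sq_to_K] at h
    have h' : ‖g‖ ^ 2 ≤ 0 := by
      have : ((-((‖g‖ : ℂ) ^ 2)).re : ℝ) = -‖g‖ ^ 2 := by
        rw [← Complex.ofReal_pow, Complex.neg_re, Complex.ofReal_re]
      have h2 : 0 ≤ -‖g‖ ^ 2 := by rw [← this]; exact h
      linarith
    exact norm_eq_zero.1 (by nlinarith [norm_nonneg g])
  let e : A ≃ₗ[ℂ] H := LinearEquiv.ofBijective (σ : A →ₗ[ℂ] H)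
    ⟨hanti.injective, LinearMap.range_eq_top.1 htop⟩
  have he (x : H) : (e.symm x).1.1 + (e.symm x).1.2 = x := e.apply_symm_apply x
  let R : H →L[ℂ] H := LinearMap.mkContinuous
    ((LinearMap.fst ℂ H H).comp (A.subtype.comp (e.symm : H →ₗ[ℂ] A))) 1 (fun x => by
      rw [one_mul]
      have := hnorm1 (e.symm x)
      rwa [hσ, he] at this)
  have hR (x : H) : R x = (e.symm x).1.1 := rfl
  have hR' (x : H) : x - R x = (e.symm x).1.2 := by
    rw [hR, sub_eq_iff_eq_add']
    exact (he x).symm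
  have hmem (x : H) : ((R x, x - R x) : H × H) ∈ A := by
    rw [hR', hR]
    exact (e.symm x).2
  have hsymm (x y : H) : inner ℂ (R x) y = inner ℂ x (R y) := by
    have := (hA.mem_iff _).1 (hmem y) _ (hmem x)
    simp only [inner_sub_left, inner_sub_right] at this
    linear_combination -this
  have h0 : 0 ≤ R := by
    rw [ContinuousLinearMap.nonneg_iff_isPositive]
    refine ⟨hsymm, fun x => ?_⟩
    change 0 ≤ (inner ℂ (R x) x).re
    have h := hA.nonneg _ (hmem x)
    have h' : 0 ≤ (inner ℂ (R x) (R x)).re := inner_self_nonneg (𝕜 := ℂ)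
    rw [inner_sub_right, Complex.sub_re] at h
    linarith
  have h1 : R ≤ 1 := by
    rw [ContinuousLinearMap.le_def]
    refine ⟨fun x y => ?_, fun x => ?_⟩
    · change inner ℂ (x - R x) y = inner ℂ x (y - R y)
      rw [inner_sub_left, inner_sub_right, hsymm]
    · change 0 ≤ (inner ℂ (x - R x) x).re
      have h := hA.nonneg _ (hmem x)
      have h' : 0 ≤ (inner ℂ (x - R x) (x - R x)).re := inner_self_nonneg (𝕜 := ℂ)
      have h2 : inner ℂ (x - R x) (R x) = inner ℂ (R x) (x - R x) := by
        rw [inner_sub_right, inner_sub_left, hsymm x x]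
      rw [inner_sub_right, Complex.sub_re, h2] at h'
      change 0 ≤ (inner ℂ (R x) (x - R x)).re at h
      linarith
  refine ⟨R, h0, h1, ?_⟩
  symm
  refine (isNonnegSelfAdjoint_ofResolvent h0 h1).eq_of_le hA fun p hp => ?_
  obtain ⟨x, hx1, hx2⟩ := mem_ofPair.1 hp
  have := hmem x
  rw [hx1] at this
  have h2 : x - p.1 = p.2 := by rw [← hx2, ← hx1]; rfl
  rwa [h2] at this

end Complete

end LinRel

/-! ### Existence and uniqueness of the square root -/

namespace LinRel

variable {H : Type*} [NormedAddCommGroup H] [InnerProductSpace ℂ H]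

theorem mem_mulPart {A : LinRel H} {m : H} : m ∈ A.mulPart ↔ ((0 : H), m) ∈ A := Iff.rfl

theorem mem_opPart {A : LinRel H} {p : H × H} :
    p ∈ A.opPart ↔ p ∈ A ∧ p.2 ∈ A.mulPartᗮ := by
  simp [opPart]

theorem mem_comp {A B : LinRel H} {p : H × H} :
    p ∈ A.comp B ↔ ∃ g, (p.1, g) ∈ B ∧ (g, p.2) ∈ A := Iff.rfl

theorem mem_mulPart_ofResolvent {R : H →L[ℂ] H} {m : H} :
    m ∈ (ofResolvent R).mulPart ↔ R m = 0 := by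
  rw [mem_mulPart, mem_ofResolvent, zero_add, eq_comm]

theorem IsNonnegSelfAdjoint.mem_mulPart_orthogonal {A : LinRel H} (hA : A.IsNonnegSelfAdjoint)
    {p : H × H} (hp : p ∈ A) : p.1 ∈ A.mulPartᗮ :=
  (Submodule.mem_orthogonal _ _).2 fun _ hm => hA.inner_eq_zero_of_mem_mulPart hp hm

variable [CompleteSpace H]

theorem commute_sqrt_left {X Y : H →L[ℂ] H} (h : Commute X Y) : Commute (CFC.sqrt X) Y :=
  h.cfcₙ_nnreal _

theorem commute_sqrt_sqrt {X Y : H →L[ℂ] H} (h : Commute X Y) :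
    Commute (CFC.sqrt X) (CFC.sqrt Y) :=
  commute_sqrt_left (commute_sqrt_left h.symm).symm

theorem commute_sqrt_sqrt_one_sub (R : H →L[ℂ] H) :
    Commute (CFC.sqrt R) (CFC.sqrt (1 - R)) :=
  commute_sqrt_sqrt ((Commute.one_right R).sub_right (Commute.refl R))

theorem sqrt_apply_sqrt_apply {R : H →L[ℂ] H} (h0 : 0 ≤ R) (x : H) :
    CFC.sqrt R (CFC.sqrt R x) = R x :=
  congrArg (fun T : H →L[ℂ] H => T x) (CFC.sqrt_mul_sqrt_self R h0)

theorem inner_sqrt_apply (R : H →L[ℂ] H) (x y : H) :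
    inner ℂ (CFC.sqrt R x) y = inner ℂ x (CFC.sqrt R y) :=
  ContinuousLinearMap.isSelfAdjoint_iff_isSymmetric.1
    (IsSelfAdjoint.of_nonneg (CFC.sqrt_nonneg R)) x y

theorem inner_sqrt_apply_sqrt_apply {R : H →L[ℂ] H} (h0 : 0 ≤ R) (x y : H) :
    inner ℂ (CFC.sqrt R x) (CFC.sqrt R y) = inner ℂ x (R y) := by
  rw [inner_sqrt_apply, sqrt_apply_sqrt_apply h0]

theorem sqrt_apply_eq_zero_iff {R : H →L[ℂ] H} (h0 : 0 ≤ R) {x : H} :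
    CFC.sqrt R x = 0 ↔ R x = 0 := by
  refine ⟨fun h => by rw [← sqrt_apply_sqrt_apply h0, h, map_zero], fun h => ?_⟩
  rw [← inner_self_eq_zero (𝕜 := ℂ), inner_sqrt_apply_sqrt_apply h0, h, inner_zero_right]

theorem sqrt_comm_sqrt_one_sub (R : H →L[ℂ] H) (x : H) :
    CFC.sqrt R (CFC.sqrt (1 - R) x) = CFC.sqrt (1 - R) (CFC.sqrt R x) :=
  congrArg (fun T : H →L[ℂ] H => T x) (commute_sqrt_sqrt_one_sub R).eq

theorem sqrt_sqrt_add_sqrt_sqrt {R : H →L[ℂ] H} (h0 : 0 ≤ R) (h1 : R ≤ 1) (x : H) :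
    CFC.sqrt R (CFC.sqrt R x) + CFC.sqrt (1 - R) (CFC.sqrt (1 - R) x) = x := by
  rw [sqrt_apply_sqrt_apply h0, sqrt_apply_sqrt_apply (sub_nonneg.2 h1)]
  simp

/-- The square root of the relation with resolvent `R`. -/
noncomputable def sqrtOfResolvent (R : H →L[ℂ] H) : LinRel H :=
  ofPair (CFC.sqrt R) (CFC.sqrt (1 - R))

theorem isNonnegSelfAdjoint_sqrtOfResolvent {R : H →L[ℂ] H} (h0 : 0 ≤ R) (h1 : R ≤ 1) :
    (sqrtOfResolvent R).IsNonnegSelfAdjoint := by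
  have hc := commute_sqrt_sqrt_one_sub R
  exact isNonnegSelfAdjoint_ofPair (U := CFC.sqrt R) (V := CFC.sqrt (1 - R))
    (IsSelfAdjoint.of_nonneg (CFC.sqrt_nonneg R))
    (IsSelfAdjoint.of_nonneg (CFC.sqrt_nonneg _)) hc
    (hc.mul_nonneg (CFC.sqrt_nonneg R) (CFC.sqrt_nonneg _)) (Commute.refl _) hc.symm hc
    (Commute.refl _)
    (by rw [CFC.sqrt_mul_sqrt_self R h0, CFC.sqrt_mul_sqrt_self _ (sub_nonneg.2 h1)]; simp)

theorem mem_mulPart_sqrtOfResolvent {R : H →L[ℂ] H} (h0 : 0 ≤ R) (h1 : R ≤ 1) {m : H} :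
    m ∈ (sqrtOfResolvent R).mulPart ↔ CFC.sqrt R m = 0 := by
  rw [mem_mulPart, sqrtOfResolvent, mem_ofPair]
  constructor
  · rintro ⟨h, h2, rfl⟩
    rw [sqrt_comm_sqrt_one_sub, h2, map_zero]
  · intro h
    refine ⟨CFC.sqrt (1 - R) m, ?_, ?_⟩
    · rw [sqrt_comm_sqrt_one_sub, h, map_zero]
    · simpa [h] using sqrt_sqrt_add_sqrt_sqrt h0 h1 m

theorem mulPart_sqrtOfResolvent {R : H →L[ℂ] H} (h0 : 0 ≤ R) (h1 : R ≤ 1) :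
    (sqrtOfResolvent R).mulPart = (ofResolvent R).mulPart := by
  ext m
  rw [mem_mulPart_sqrtOfResolvent h0 h1, mem_mulPart_ofResolvent, sqrt_apply_eq_zero_iff h0]

theorem sqrt_apply_mem_orthogonal {R : H →L[ℂ] H} (h0 : 0 ≤ R) (h1 : R ≤ 1) (x : H) :
    CFC.sqrt R x ∈ (sqrtOfResolvent R).mulPartᗮ := by
  refine (Submodule.mem_orthogonal _ _).2 fun m hm => ?_
  rw [← inner_sqrt_apply, (mem_mulPart_sqrtOfResolvent h0 h1).1 hm, inner_zero_left]

theorem isSqrt_sqrtOfResolvent {R : H →L[ℂ] H} (h0 : 0 ≤ R) (h1 : R ≤ 1) :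
    IsSqrt (ofResolvent R) (sqrtOfResolvent R) where
  nonnegSelfAdjoint := isNonnegSelfAdjoint_sqrtOfResolvent h0 h1
  mulPart_eq := mulPart_sqrtOfResolvent h0 h1
  opPart_comp := by
    have hmul := mulPart_sqrtOfResolvent h0 h1
    ext ⟨f, g⟩
    rw [mem_comp, mem_opPart]
    constructor
    · rintro ⟨k, hk, hk'⟩
      rw [mem_opPart] at hk hk'
      obtain ⟨x, hx1, hx2⟩ := mem_ofPair.1 hk.1
      obtain ⟨y, hy1, hy2⟩ := mem_ofPair.1 hk'.1
      dsimp only at hx1 hx2 hy1 hy2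
      refine ⟨mem_ofResolvent.2 ?_, hmul ▸ hk'.2⟩
      dsimp only
      rw [← sqrt_apply_sqrt_apply h0 (f + g), ← hy2, map_add, sqrt_comm_sqrt_one_sub, hy1, ← hx2,
        ← hx1, sqrt_sqrt_add_sqrt_sqrt h0 h1]
    · rintro ⟨h, hg⟩
      have hf := mem_ofResolvent.1 h
      dsimp only at hf hg
      set x := f + g with hx
      -- The middle vector is in the range of `R^{1/2}`, hence orthogonal to `ker R^{1/2}`, which is
      -- the multivalued part.
      refine ⟨CFC.sqrt R (CFC.sqrt (1 - R) x), mem_opPart.2 ⟨mem_ofPair.2 ⟨CFC.sqrt R x, ?_, ?_⟩,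
        sqrt_apply_mem_orthogonal h0 h1 _⟩, mem_opPart.2 ⟨mem_ofPair.2
        ⟨CFC.sqrt (1 - R) x, rfl, ?_⟩, hmul ▸ hg⟩⟩
      · rw [sqrt_apply_sqrt_apply h0, ← hf]
      · exact (sqrt_comm_sqrt_one_sub R x).symm
      · rw [sqrt_apply_sqrt_apply (sub_nonneg.2 h1)]
        change x - R x = g
        rw [← hf, hx, add_sub_cancel_left]

theorem IsNonnegSelfAdjoint.exists_mem_opPart {A : LinRel H} (hA : A.IsNonnegSelfAdjoint)
    {p : H × H} (hp : p ∈ A) : ∃ g, (p.1, g) ∈ A.opPart ∧ p.2 - g ∈ A.mulPart := by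
  have : CompleteSpace A.mulPart := hA.isClosed_mulPart.completeSpace_coe
  obtain ⟨m, hm, g, hg, h⟩ := A.mulPart.exists_add_mem_mem_orthogonal p.2
  have hsub : p.2 - g = m := by rw [h]; abel
  refine ⟨g, mem_opPart.2 ⟨?_, hg⟩, hsub ▸ hm⟩
  have h2 := A.sub_mem hp (mem_mulPart.1 hm)
  have : p - (0, m) = (p.1, g) := by ext <;> simp [h]
  rwa [this] at h2

/-- The defining identity concerns operator parts only. The middle vector is a first component of
`T`, hence orthogonal to `mul T`, so the first pair is already in the operator part. The second
differs from one there by an element of `mul T = mul A`. -/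
theorem IsSqrt.comp_le {A T : LinRel H} (hT : IsSqrt A T) : T.comp T ≤ A := by
  rintro ⟨f, h⟩ ⟨g, hfg, hgh⟩
  obtain ⟨h', hh', hsub⟩ := hT.nonnegSelfAdjoint.exists_mem_opPart hgh
  have hmem : (f, h') ∈ A.opPart := by
    rw [← hT.opPart_comp]
    exact ⟨g, mem_opPart.2 ⟨hfg, hT.nonnegSelfAdjoint.mem_mulPart_orthogonal hgh⟩, hh'⟩
  have := A.add_mem (mem_opPart.1 hmem).1 (mem_mulPart.1 (hT.mulPart_eq ▸ hsub))
  simpa using this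

/-- Let `Q` be the resolvent of `T`. Since `T` composed with itself contains the pairs `(Q² x, (1 -
Q)² x)`, whose components add up to `D x`, one gets `R D = Q²` and `(1 - R) D = (1 - Q)²`.
Uniqueness of positive square roots gives `R^{1/2} D^{1/2} = Q` and `(1 - R)^{1/2} D^{1/2} = 1 - Q`.
So `T` is contained in the canonical square root, with parameter `D^{1/2} x`, and maximality
concludes. -/
theorem IsSqrt.eq_sqrtOfResolvent {R : H →L[ℂ] H} (h0 : 0 ≤ R) (h1 : R ≤ 1) {T : LinRel H}
    (hT : IsSqrt (ofResolvent R) T) : T = sqrtOfResolvent R := by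
  obtain ⟨Q, hQ0, hQ1, rfl⟩ := hT.nonnegSelfAdjoint.exists_eq_ofResolvent
  have hQ1' := sub_nonneg.2 hQ1
  set D : H →L[ℂ] H := Q * Q + (1 - Q) * (1 - Q) with hD
  have hQc : Commute Q (1 - Q) := (Commute.one_right Q).sub_right (Commute.refl Q)
  have hD0 : 0 ≤ D := add_nonneg ((Commute.refl Q).mul_nonneg hQ0 hQ0)
    ((Commute.refl _).mul_nonneg hQ1' hQ1')
  have hRD : R * D = Q * Q := by
    ext x
    have hmem : ((Q (Q x), (1 - Q) ((1 - Q) x)) : H × H) ∈ ofResolvent R := by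
      refine hT.comp_le ⟨Q ((1 - Q) x), mem_ofPair.2 ⟨Q x, rfl, ?_⟩, mem_ofPair.2
        ⟨(1 - Q) x, rfl, rfl⟩⟩
      exact congrArg (fun T : H →L[ℂ] H => T x) hQc.eq.symm
    exact (mem_ofResolvent.1 hmem).symm
  -- Taking adjoints in `R D = Q²` gives `D R = Q²`.
  have hRDc : Commute R D := by
    have h := congrArg star hRD
    rw [star_mul, star_mul, (IsSelfAdjoint.of_nonneg h0).star_eq,
      (IsSelfAdjoint.of_nonneg hQ0).star_eq, (IsSelfAdjoint.of_nonneg hD0).star_eq] at h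
    exact hRD.trans h.symm
  have hRDc' : Commute (1 - R) D := (Commute.one_left D).sub_left hRDc
  have hRD' : (1 - R) * D = (1 - Q) * (1 - Q) := by
    rw [sub_mul, hRD, one_mul, hD, add_sub_cancel_left]
  have key {X Y : H →L[ℂ] H} (hX : 0 ≤ X) (hY : 0 ≤ Y) (hc : Commute X D) (h : X * D = Y * Y) :
      CFC.sqrt X * CFC.sqrt D = Y := by
    have hc' := commute_sqrt_sqrt hc
    rw [← CFC.sqrt_mul_self Y hY]
    symm
    apply CFC.sqrt_unique
    · rw [hc'.symm.mul_mul_mul_comm, CFC.sqrt_mul_sqrt_self X hX, CFC.sqrt_mul_sqrt_self D hD0, h]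
    · exact hc'.mul_nonneg (CFC.sqrt_nonneg _) (CFC.sqrt_nonneg _)
  have k1 := key h0 hQ0 hRDc hRD
  have k2 := key (sub_nonneg.2 h1) hQ1' hRDc' hRD'
  refine hT.nonnegSelfAdjoint.eq_of_le (isNonnegSelfAdjoint_sqrtOfResolvent h0 h1) fun p hp => ?_
  obtain ⟨x, hx1, hx2⟩ := mem_ofPair.1 hp
  exact mem_ofPair.2 ⟨CFC.sqrt D x, by rw [← hx1, ← k1]; rfl, by rw [← hx2, ← k2]; rfl⟩

theorem sqrt_ofResolvent {R : H →L[ℂ] H} (h0 : 0 ≤ R) (h1 : R ≤ 1) :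
    (ofResolvent R).sqrt = sqrtOfResolvent R := by
  have h : ∃ S, IsSqrt (ofResolvent R) S := ⟨_, isSqrt_sqrtOfResolvent h0 h1⟩
  rw [sqrt, dif_pos h]
  exact h.choose_spec.eq_sqrtOfResolvent h0 h1

theorem ran_sqrt_ofResolvent {R : H →L[ℂ] H} (h0 : 0 ≤ R) (h1 : R ≤ 1) :
    (ofResolvent R).sqrt.ran = LinearMap.range (CFC.sqrt (1 - R)).toLinearMap := by
  ext x
  rw [sqrt_ofResolvent h0 h1, ran]
  constructor
  · rintro ⟨p, hp, rfl⟩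
    obtain ⟨y, -, hy⟩ := mem_ofPair.1 hp
    exact ⟨y, hy⟩
  · rintro ⟨y, rfl⟩
    exact ⟨(CFC.sqrt R y, CFC.sqrt (1 - R) y), mem_ofPair.2 ⟨y, rfl, rfl⟩, rfl⟩

end LinRel

/-- A vector `u` whose pairings are dominated by `‖J† ·‖` lies in the range of `J`. -/
theorem ContinuousLinearMap.exists_apply_eq_of_norm_inner_le {H K : Type*} [NormedAddCommGroup H]
    [InnerProductSpace ℂ H] [CompleteSpace H] [NormedAddCommGroup K] [InnerProductSpace ℂ K]
    [CompleteSpace K] (J : K →L[ℂ] H) {u : H} {M : ℝ} (hM : 0 ≤ M)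
    (h : ∀ x, ‖inner ℂ u x‖ ≤ M * ‖(J†) x‖) : ∃ y, J y = u ∧ ‖y‖ ≤ M := by
  let L : Submodule ℂ K := (LinearMap.range (J†).toLinearMap).topologicalClosure
  have : CompleteSpace L := (Submodule.isClosed_topologicalClosure _).completeSpace_coe
  let e : H →ₗ[ℂ] L := LinearMap.codRestrict L (J†).toLinearMap
    fun x => Submodule.le_topologicalClosure _ ⟨x, rfl⟩
  have he (x : H) : ((e x : L) : K) = (J†) x := rfl
  have hdense : DenseRange e := by
    rintro ⟨y, hy⟩
    rw [closure_subtype]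
    have : ((↑) '' Set.range e : Set K) = LinearMap.range (J†).toLinearMap := by
      ext z
      simp [he]
    rw [this]
    exact hy
  let l : H →ₗ[ℂ] ℂ := (innerSL ℂ u).toLinearMap
  have hl (x : H) : ‖l x‖ ≤ M * ‖e x‖ := h x
  -- The functional `J† x ↦ (u, x)` is bounded by `M` on the range of `J†`, which is dense in `L`.
  -- The vector `y` represents its extension.
  let y : L := (InnerProductSpace.toDual ℂ L).symm (l.extendOfNorm e)
  have hy (z : L) : inner ℂ y z = l.extendOfNorm e z :=
    InnerProductSpace.toDual_symm_apply
  refine ⟨y, ?_, ?_⟩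
  · refine ext_inner_right ℂ fun x => ?_
    rw [← ContinuousLinearMap.adjoint_inner_right, ← he, ← Submodule.coe_inner, hy,
      LinearMap.extendOfNorm_eq hdense ⟨M, hl⟩]
    rfl
  · change ‖y‖ ≤ M
    rw [LinearIsometryEquiv.norm_map]
    exact ContinuousLinearMap.opNorm_le_bound _ hM
      (LinearMap.norm_extendOfNorm_apply_le hdense M hl)

/-! ### Closed forms represented by a contraction `J` -/

namespace SesqForm

variable {H : Type*} [NormedAddCommGroup H] [InnerProductSpace ℂ H]

theorem ext_quadratic {a b : SesqForm H} (hdom : a.dom = b.dom)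
    (h : ∀ u (hu : u ∈ a.dom) (hu' : u ∈ b.dom),
      a.toFun ⟨u, hu⟩ ⟨u, hu⟩ = b.toFun ⟨u, hu'⟩ ⟨u, hu'⟩) :
    a = b := by
  obtain ⟨D, f⟩ := a
  obtain ⟨D', g⟩ := b
  obtain rfl : D = D' := hdom
  have hq (x : D) : f x x = g x x := h x x.2 x.2
  congr 1
  ext x y
  -- Polarization for `d = f - g`: the vector `x + y` gives `d x y + d y x = 0`, and `x + i y` gives
  -- `d x y - d y x = 0`.
  have h1 := hq (x + y)
  have h2 := hq (x + Complex.I • y)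
  simp only [map_add, LinearMap.add_apply, map_smul, LinearMap.map_smulₛₗ, LinearMap.smul_apply,
    Complex.conj_I, smul_eq_mul, hq x, hq y] at h1 h2
  linear_combination (1 / 2 : ℂ) * h1 - (Complex.I / 2) * h2 +
    (1 / 2 : ℂ) * (f x y - g x y - f y x + g y x) * Complex.I_sq

/-- The completion picture of a closed nonnegative form `a`: the injective contraction `J` maps a
Hilbert space `K` onto `dom a`, and the inner product of `K` is `a[·,·] + (·,·)`. -/
structure IsRepresentedBy (a : SesqForm H) {K : Type*} [NormedAddCommGroup K]
    [InnerProductSpace ℂ K] (J : K →L[ℂ] H) : Prop where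
  injective : Function.Injective J
  dom_eq : a.dom = LinearMap.range J.toLinearMap
  norm_le : ∀ x, ‖J x‖ ≤ ‖x‖
  apply_add : ∀ x y (hx : J x ∈ a.dom) (hy : J y ∈ a.dom),
    a.toFun ⟨J x, hx⟩ ⟨J y, hy⟩ + inner ℂ (J x) (J y) = inner ℂ x y

variable {K : Type*} [NormedAddCommGroup K] [InnerProductSpace ℂ K]

theorem IsRepresentedBy.apply_self_add {a : SesqForm H} {J : K →L[ℂ] H} (ha : a.IsRepresentedBy J)
    (x : K) (hx : J x ∈ a.dom) :
    (a.toFun ⟨J x, hx⟩ ⟨J x, hx⟩).re + ‖J x‖ ^ 2 = ‖x‖ ^ 2 := by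
  have := congrArg Complex.re (ha.apply_add x x hx hx)
  rw [Complex.add_re] at this
  have h1 : (inner ℂ x x).re = ‖x‖ ^ 2 := inner_self_eq_norm_sq (𝕜 := ℂ) x
  have h2 : (inner ℂ (J x) (J x)).re = ‖J x‖ ^ 2 := inner_self_eq_norm_sq (𝕜 := ℂ) (J x)
  rwa [h1, h2] at this

theorem IsRepresentedBy.apply_self_im {a : SesqForm H} {J : K →L[ℂ] H} (ha : a.IsRepresentedBy J)
    {u : H} (hu : u ∈ a.dom) : (a.toFun ⟨u, hu⟩ ⟨u, hu⟩).im = 0 := by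
  have hu' := hu
  rw [ha.dom_eq] at hu'
  obtain ⟨x, rfl⟩ := hu'
  have := congrArg Complex.im (ha.apply_add x x hu hu)
  have h1 : (inner ℂ x x).im = 0 := inner_self_im (𝕜 := ℂ) x
  have h2 : (inner ℂ (J x) (J x)).im = 0 := inner_self_im (𝕜 := ℂ) (J x)
  rw [Complex.add_im, h1, h2, add_zero] at this
  exact this

theorem IsRepresentedBy.re_apply_self_nonneg {a : SesqForm H} {J : K →L[ℂ] H}
    (ha : a.IsRepresentedBy J) {u : H} (hu : u ∈ a.dom) :
    0 ≤ (a.toFun ⟨u, hu⟩ ⟨u, hu⟩).re := by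
  have hu' := hu
  rw [ha.dom_eq] at hu'
  obtain ⟨x, rfl⟩ := hu'
  change 0 ≤ (a.toFun ⟨J x, hu⟩ ⟨J x, hu⟩).re
  have h1 := ha.apply_self_add x hu
  have h2 := pow_le_pow_left₀ (norm_nonneg _) (ha.norm_le x) 2
  linarith

variable [CompleteSpace H] [CompleteSpace K]

theorem norm_adjoint_apply_sq (J : K →L[ℂ] H) (x : H) :
    ‖(J†) x‖ ^ 2 = (inner ℂ x ((J ∘L J†) x)).re := by
  rw [ContinuousLinearMap.comp_apply, ← ContinuousLinearMap.adjoint_inner_left]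
  exact (inner_self_eq_norm_sq (𝕜 := ℂ) _).symm

/-- The variational description of a closed form by the resolvent `J J†` of its relation. -/
theorem IsRepresentedBy.le_iff {a : SesqForm H} {J : K →L[ℂ] H} (ha : a.IsRepresentedBy J)
    {u : H} {c : ℝ} (hc : 0 ≤ c) :
    (∃ hu : u ∈ a.dom, (a.toFun ⟨u, hu⟩ ⟨u, hu⟩).re + ‖u‖ ^ 2 ≤ c) ↔
      ∀ x, ‖inner ℂ u x‖ ^ 2 ≤ c * (inner ℂ x ((J ∘L J†) x)).re := by
  constructor
  · rintro ⟨hu, h⟩ x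
    have hu' := hu
    rw [ha.dom_eq] at hu'
    obtain ⟨y, rfl⟩ := hu'
    change (a.toFun ⟨J y, hu⟩ ⟨J y, hu⟩).re + ‖J y‖ ^ 2 ≤ c at h
    change ‖inner ℂ (J y) x‖ ^ 2 ≤ _
    rw [ha.apply_self_add] at h
    rw [← norm_adjoint_apply_sq, ← ContinuousLinearMap.adjoint_inner_right]
    calc ‖inner ℂ y ((J†) x)‖ ^ 2 ≤ (‖y‖ * ‖(J†) x‖) ^ 2 := by
          gcongr
          exact norm_inner_le_norm _ _
      _ = ‖y‖ ^ 2 * ‖(J†) x‖ ^ 2 := by ring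
      _ ≤ _ := by gcongr
  · intro h
    -- The hypothesis reads `|(u, x)| ≤ √c ‖J† x‖`, so `u = J y` with `‖y‖² ≤ c`.
    obtain ⟨y, rfl, hy⟩ := J.exists_apply_eq_of_norm_inner_le (u := u) (Real.sqrt_nonneg c)
      fun x => by
        refine (sq_le_sq₀ (norm_nonneg _) (by positivity)).1 ?_
        rw [mul_pow, Real.sq_sqrt hc, norm_adjoint_apply_sq]
        exact h x
    have hu : J y ∈ a.dom := by
      rw [ha.dom_eq]
      exact ⟨y, rfl⟩
    refine ⟨hu, ?_⟩
    rw [ha.apply_self_add, ← Real.sq_sqrt hc]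
    gcongr

/-- A larger `J J†` weakens the variational condition; it is applied with `c = b[u] + ‖u‖²`. -/
theorem IsRepresentedBy.dom_le_and_le {a b : SesqForm H} {J : K →L[ℂ] H}
    (ha : a.IsRepresentedBy J) {K' : Type*} [NormedAddCommGroup K'] [InnerProductSpace ℂ K']
    [CompleteSpace K'] {J' : K' →L[ℂ] H} (hb : b.IsRepresentedBy J')
    (h : ∀ x, (inner ℂ x ((J' ∘L J'†) x)).re ≤ (inner ℂ x ((J ∘L J†) x)).re) {u : H}
    (hu : u ∈ b.dom) :
    ∃ hu' : u ∈ a.dom,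
      (a.toFun ⟨u, hu'⟩ ⟨u, hu'⟩).re ≤ (b.toFun ⟨u, hu⟩ ⟨u, hu⟩).re := by
  have h0 := hb.re_apply_self_nonneg hu
  have hc : 0 ≤ (b.toFun ⟨u, hu⟩ ⟨u, hu⟩).re + ‖u‖ ^ 2 := by positivity
  obtain ⟨hu', h'⟩ := (ha.le_iff hc).2 fun x =>
    ((hb.le_iff hc).1 ⟨hu, le_rfl⟩ x).trans (mul_le_mul_of_nonneg_left (h x) hc)
  exact ⟨hu', by linarith⟩

theorem IsRepresentedBy.eq_of_comp_adjoint_eq {a b : SesqForm H} {J : K →L[ℂ] H}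
    (ha : a.IsRepresentedBy J) {K' : Type*} [NormedAddCommGroup K'] [InnerProductSpace ℂ K']
    [CompleteSpace K'] {J' : K' →L[ℂ] H} (hb : b.IsRepresentedBy J')
    (h : J ∘L J† = J' ∘L J'†) : a = b := by
  have h1 {u : H} := ha.dom_le_and_le hb (fun x => by rw [h]) (u := u)
  have h2 {u : H} := hb.dom_le_and_le ha (fun x => by rw [h]) (u := u)
  refine ext_quadratic (le_antisymm (fun u hu => (h2 hu).1) fun u hu => (h1 hu).1)
    fun u hu hu' => Complex.ext (le_antisymm (h1 hu').2 (h2 hu).2) ?_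
  rw [ha.apply_self_im, hb.apply_self_im]

theorem nonneg_comp_adjoint (J : K →L[ℂ] H) : 0 ≤ J ∘L J† :=
  (ContinuousLinearMap.nonneg_iff_isPositive _).2 (ContinuousLinearMap.isPositive_self_comp_adjoint J)

theorem IsRepresentedBy.comp_adjoint_le_one {a : SesqForm H} {J : K →L[ℂ] H}
    (ha : a.IsRepresentedBy J) : J ∘L J† ≤ 1 := by
  have hJ : ‖J‖ ≤ 1 := J.opNorm_le_bound zero_le_one fun x => by
    rw [one_mul]
    exact ha.norm_le x
  rw [ContinuousLinearMap.le_def]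
  have hsymm := (ContinuousLinearMap.isPositive_self_comp_adjoint J).isSymmetric
  refine ⟨fun x y => ?_, fun x => ?_⟩
  · change inner ℂ (x - (J ∘L J†) x) y = inner ℂ x (y - (J ∘L J†) y)
    rw [inner_sub_left, inner_sub_right]
    exact congrArg _ (hsymm x y)
  · change 0 ≤ (inner ℂ (x - (J ∘L J†) x) x).re
    have h1 : (inner ℂ x x).re = ‖x‖ ^ 2 := inner_self_eq_norm_sq (𝕜 := ℂ) x
    have h2 : inner ℂ ((J ∘L J†) x) x = inner ℂ x ((J ∘L J†) x) := hsymm x x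
    rw [inner_sub_left, Complex.sub_re, h2, ← norm_adjoint_apply_sq, h1, sub_nonneg]
    gcongr
    refine ((J†).le_of_opNorm_le (c := 1) ?_ x).trans_eq (one_mul _)
    rwa [LinearIsometryEquiv.norm_map]

/-- The first representation theorem: the relation of a closed form has resolvent `J J†`. -/
theorem IsRepresentedBy.toRel_eq {a : SesqForm H} {J : K →L[ℂ] H} (ha : a.IsRepresentedBy J) :
    a.toRel = LinRel.ofResolvent (J ∘L J†) := by
  have hmem (x : K) : J x ∈ a.dom := by
    rw [ha.dom_eq]
    exact ⟨x, rfl⟩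
  ext ⟨f, g⟩
  rw [LinRel.mem_ofResolvent, ContinuousLinearMap.comp_apply]
  constructor
  · rintro ⟨hf, h⟩
    dsimp only at hf h ⊢
    have hf' := hf
    rw [ha.dom_eq] at hf'
    obtain ⟨x, rfl⟩ := hf'
    change ∀ ψ : a.dom, a.toFun ψ ⟨J x, hf⟩ = _ at h
    change J x = J ((J†) (J x + g))
    congr 1
    refine ext_inner_left ℂ fun y => ?_
    rw [ContinuousLinearMap.adjoint_inner_right, inner_add_right, ← ha.apply_add y x (hmem y) hf,
      h ⟨J y, hmem y⟩, add_comm]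
  · intro h
    dsimp only at h
    have hf : f ∈ a.dom := by
      rw [h]
      exact hmem _
    refine ⟨hf, fun ψ => ?_⟩
    obtain ⟨ψ, hψ⟩ := ψ
    have hψ' := hψ
    rw [ha.dom_eq] at hψ'
    obtain ⟨y, rfl⟩ := hψ'
    have h2 := ha.apply_add y ((J†) (f + g)) hψ (hmem _)
    rw [ContinuousLinearMap.adjoint_inner_right, inner_add_right] at h2
    simp only [← h] at h2
    change a.toFun ⟨J y, hψ⟩ ⟨f, hf⟩ = inner ℂ (J y) g
    linear_combination h2

end SesqForm

/-! ### The form of a relation and the form order -/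

namespace LinRel

variable {H : Type*} [NormedAddCommGroup H] [InnerProductSpace ℂ H]

theorem le_of_re_inner_le {R R' : H →L[ℂ] H} (hR : 0 ≤ R) (hR' : 0 ≤ R')
    (h : ∀ x, (inner ℂ x (R x)).re ≤ (inner ℂ x (R' x)).re) : R ≤ R' := by
  have s := ((ContinuousLinearMap.nonneg_iff_isPositive _).1 hR).isSymmetric
  have s' := ((ContinuousLinearMap.nonneg_iff_isPositive _).1 hR').isSymmetric
  rw [ContinuousLinearMap.le_def]
  have hs : ((R' - R : H →L[ℂ] H) : H →ₗ[ℂ] H).IsSymmetric := s'.sub s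
  refine ⟨hs, fun x => ?_⟩
  change 0 ≤ (inner ℂ ((R' - R) x) x).re
  rw [show inner ℂ ((R' - R) x) x = inner ℂ x ((R' - R) x) from hs x x]
  change 0 ≤ (inner ℂ x (R' x - R x)).re
  rw [inner_sub_right, Complex.sub_re]
  linarith [h x]

theorem eq_zero_of_mem_opPart {A : LinRel H} {g : H} (h : ((0 : H), g) ∈ A.opPart) : g = 0 := by
  obtain ⟨h1, h2⟩ := mem_opPart.1 h
  exact inner_self_eq_zero.1 ((Submodule.mem_orthogonal _ _).1 h2 g h1)

theorem isClosed_opPart {A : LinRel H} (hA : A.IsNonnegSelfAdjoint) :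
    IsClosed (A.opPart : Set (H × H)) := by
  have : (A.opPart : Set (H × H)) = (A : Set (H × H)) ∩ Prod.snd ⁻¹' (A.mulPartᗮ : Set H) := by
    ext p
    exact mem_opPart
  rw [this]
  exact hA.isClosed.inter ((Submodule.isClosed_orthogonal _).preimage continuous_snd)

theorem re_inner_le_of_le {R R' : H →L[ℂ] H} (h : R ≤ R') (x : H) :
    (inner ℂ x (R x)).re ≤ (inner ℂ x (R' x)).re := by
  have := ((ContinuousLinearMap.le_def _ _).1 h).re_inner_nonneg_right x
  change 0 ≤ (inner ℂ x (R' x - R x)).re at this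
  rw [inner_sub_right, Complex.sub_re] at this
  linarith

theorem graph_sqrtOp (A : LinRel H) : A.sqrtOp.graph = A.sqrt.opPart :=
  Submodule.toLinearPMap_graph_eq _ fun p hp h => by
    obtain ⟨f, g⟩ := p
    obtain rfl : f = 0 := h
    exact eq_zero_of_mem_opPart hp

theorem mem_form_dom {A : LinRel H} {u : H} : u ∈ A.form.dom ↔ ∃ g, (u, g) ∈ A.sqrt.opPart := by
  rw [← graph_sqrtOp]
  exact LinearPMap.mem_domain_iff

theorem sqrtOp_apply {A : LinRel H} {u g : H} (hu : u ∈ A.sqrtOp.domain)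
    (h : (u, g) ∈ A.sqrt.opPart) : A.sqrtOp ⟨u, hu⟩ = g := by
  rw [← graph_sqrtOp] at h
  exact LinearPMap.mem_graph_snd_inj _ (A.sqrtOp.mem_graph ⟨u, hu⟩) h rfl

theorem form_apply {A : LinRel H} {u v g k : H} (hu : u ∈ A.form.dom) (hv : v ∈ A.form.dom)
    (hg : (u, g) ∈ A.sqrt.opPart) (hk : (v, k) ∈ A.sqrt.opPart) :
    A.form.toFun ⟨u, hu⟩ ⟨v, hv⟩ = inner ℂ g k := by
  rw [← sqrtOp_apply hu hg, ← sqrtOp_apply hv hk]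
  rfl

theorem re_form_apply_self {A : LinRel H} {u : H} (hu : u ∈ A.form.dom) :
    (A.form.toFun ⟨u, hu⟩ ⟨u, hu⟩).re = ‖A.sqrtOp ⟨u, hu⟩‖ ^ 2 :=
  inner_self_eq_norm_sq (𝕜 := ℂ) _

theorem formLE_iff_form {A B : LinRel H} :
    A.FormLE B ↔ ∀ u (hu : u ∈ B.form.dom), ∃ hu' : u ∈ A.form.dom,
      (A.form.toFun ⟨u, hu'⟩ ⟨u, hu'⟩).re ≤ (B.form.toFun ⟨u, hu⟩ ⟨u, hu⟩).re := by
  constructor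
  · rintro ⟨h, hle⟩ u hu
    refine ⟨h hu, ?_⟩
    exact (re_form_apply_self _).trans_le ((pow_le_pow_left₀ (norm_nonneg _) (hle ⟨u, hu⟩) 2).trans_eq
      (re_form_apply_self hu).symm)
  · intro h
    refine ⟨fun u hu => (h u hu).1, fun u => ?_⟩
    obtain ⟨hu', hle⟩ := h u u.2
    exact (sq_le_sq₀ (norm_nonneg _) (norm_nonneg _)).1
      ((re_form_apply_self hu').symm.trans_le (hle.trans_eq (re_form_apply_self u.2)))

/-- The form order is the reverse of the order of the resolvents. -/
theorem FormLE.refl (A : LinRel H) : A.FormLE A := ⟨le_rfl, fun _ => le_rfl⟩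

variable [CompleteSpace H]

theorem IsNonnegSelfAdjoint.isNonnegSelfAdjoint_sqrt {A : LinRel H}
    (hA : A.IsNonnegSelfAdjoint) : A.sqrt.IsNonnegSelfAdjoint := by
  obtain ⟨R, h0, h1, rfl⟩ := hA.exists_eq_ofResolvent
  rw [sqrt_ofResolvent h0 h1]
  exact isNonnegSelfAdjoint_sqrtOfResolvent h0 h1

theorem mem_opPart_sqrtOfResolvent {R : H →L[ℂ] H} (h0 : 0 ≤ R) (h1 : R ≤ 1) {p : H × H} :
    p ∈ (sqrtOfResolvent R).opPart ↔
      ∃ x ∈ (sqrtOfResolvent R).mulPartᗮ, CFC.sqrt R x = p.1 ∧ CFC.sqrt (1 - R) x = p.2 := by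
  set N := (sqrtOfResolvent R).mulPart with hN
  have hmem {x : H} : x ∈ N ↔ CFC.sqrt R x = 0 := mem_mulPart_sqrtOfResolvent h0 h1
  have horth {x : H} (hx : x ∈ Nᗮ) : CFC.sqrt (1 - R) x ∈ Nᗮ := by
    refine (Submodule.mem_orthogonal _ _).2 fun m hm => ?_
    rw [← inner_sqrt_apply]
    refine (Submodule.mem_orthogonal _ _).1 hx _ (hmem.2 ?_)
    rw [sqrt_comm_sqrt_one_sub, hmem.1 hm, map_zero]
  constructor
  · intro hp
    obtain ⟨hp1, hp2⟩ := mem_opPart.1 hp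
    obtain ⟨x, hx1, hx2⟩ := mem_ofPair.1 hp1
    have : CompleteSpace N :=
      (isNonnegSelfAdjoint_sqrtOfResolvent h0 h1).isClosed_mulPart.completeSpace_coe
    obtain ⟨m, hm, y, hy, rfl⟩ := N.exists_add_mem_mem_orthogonal x
    refine ⟨y, hy, ?_, ?_⟩
    · rw [← hx1, map_add, hmem.1 hm, zero_add]
    -- The component `m` of the parameter in `N` contributes nothing: its image under `(1 -
    -- R)^{1/2}` lies in both `N` and `Nᗮ`.
    · have h3 : CFC.sqrt (1 - R) m ∈ N := hmem.2 (by
        rw [sqrt_comm_sqrt_one_sub, hmem.1 hm, map_zero])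
      have h4 : CFC.sqrt (1 - R) m ∈ Nᗮ := by
        have : CFC.sqrt (1 - R) m = p.2 - CFC.sqrt (1 - R) y := by
          rw [← hx2, map_add, add_sub_cancel_right]
        rw [this]
        exact Nᗮ.sub_mem hp2 (horth hy)
      rw [← hx2, map_add, inner_self_eq_zero.1 ((Submodule.mem_orthogonal _ _).1 h4 _ h3),
        zero_add]
  · rintro ⟨x, hx, hx1, hx2⟩
    exact mem_opPart.2 ⟨mem_ofPair.2 ⟨x, hx1, hx2⟩, hx2 ▸ horth hx⟩

/-- The form of a nonnegative selfadjoint relation with resolvent `R` is represented by the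
restriction of `R^{1/2}` to the orthogonal complement of its kernel. -/
theorem exists_form_isRepresentedBy {R : H →L[ℂ] H} (h0 : 0 ≤ R) (h1 : R ≤ 1) :
    ∃ (N : Submodule ℂ H) (_ : CompleteSpace N) (J : N →L[ℂ] H),
      (ofResolvent R).form.IsRepresentedBy J ∧ J ∘L J† = R := by
  set N := (sqrtOfResolvent R).mulPart with hN
  have hmem {x : H} : x ∈ N ↔ CFC.sqrt R x = 0 := mem_mulPart_sqrtOfResolvent h0 h1
  have hop {p : H × H} : p ∈ (ofResolvent R).sqrt.opPart ↔
      ∃ x ∈ Nᗮ, CFC.sqrt R x = p.1 ∧ CFC.sqrt (1 - R) x = p.2 := by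
    rw [sqrt_ofResolvent h0 h1]
    exact mem_opPart_sqrtOfResolvent h0 h1
  have hsum (x y : H) : inner ℂ (CFC.sqrt (1 - R) x) (CFC.sqrt (1 - R) y) +
      inner ℂ (CFC.sqrt R x) (CFC.sqrt R y) = inner ℂ x y := by
    rw [inner_sqrt_apply_sqrt_apply h0, inner_sqrt_apply_sqrt_apply (sub_nonneg.2 h1),
      ← inner_add_right]
    congr 1
    simp
  refine ⟨Nᗮ, inferInstance, (CFC.sqrt R).comp Nᗮ.subtypeL, ⟨?_, ?_, ?_, ?_⟩, ?_⟩
  · refine (injective_iff_map_eq_zero _).2 fun x hx => ?_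
    have hx' : (x : H) ∈ N := hmem.2 hx
    exact Subtype.ext (inner_self_eq_zero.1 ((Submodule.mem_orthogonal _ _).1 x.2 x hx'))
  · ext u
    rw [mem_form_dom]
    constructor
    · rintro ⟨g, hg⟩
      obtain ⟨x, hx, hx1, -⟩ := hop.1 hg
      exact ⟨⟨x, hx⟩, hx1⟩
    · rintro ⟨x, hx⟩
      exact ⟨_, hop.2 ⟨x, x.2, hx, rfl⟩⟩
  · intro x
    have h := congrArg Complex.re (hsum x x)
    rw [Complex.add_re] at h
    have e1 (z : H) : (inner ℂ z z).re = ‖z‖ ^ 2 := inner_self_eq_norm_sq (𝕜 := ℂ) z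
    rw [e1, e1, e1] at h
    change ‖CFC.sqrt R (x : H)‖ ≤ ‖(x : H)‖
    refine (sq_le_sq₀ (norm_nonneg _) (norm_nonneg _)).1 ?_
    nlinarith [sq_nonneg ‖CFC.sqrt (1 - R) (x : H)‖]
  · intro x y hx hy
    rw [form_apply hx hy (hop.2 ⟨x, x.2, rfl, rfl⟩) (hop.2 ⟨y, y.2, rfl, rfl⟩)]
    exact hsum x y
  · ext x
    have hx : CFC.sqrt R x ∈ Nᗮ := sqrt_apply_mem_orthogonal h0 h1 x
    rw [ContinuousLinearMap.comp_apply, ContinuousLinearMap.adjoint_comp,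
      Submodule.adjoint_subtypeL, ContinuousLinearMap.comp_apply,
      (IsSelfAdjoint.of_nonneg (CFC.sqrt_nonneg R)).adjoint_eq]
    change CFC.sqrt R (Nᗮ.starProjection (CFC.sqrt R x)) = _
    rw [Submodule.starProjection_eq_self_iff.2 hx]
    exact sqrt_apply_sqrt_apply h0 x

theorem IsNonnegSelfAdjoint.toRel_form {A : LinRel H} (hA : A.IsNonnegSelfAdjoint) :
    A.form.toRel = A := by
  obtain ⟨R, h0, h1, rfl⟩ := hA.exists_eq_ofResolvent
  obtain ⟨N, _, J, hJ, hR⟩ := exists_form_isRepresentedBy h0 h1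
  rw [hJ.toRel_eq, hR]

theorem form_le_iff {R : H →L[ℂ] H} (h0 : 0 ≤ R) (h1 : R ≤ 1) {u : H} {c : ℝ} (hc : 0 ≤ c) :
    (∃ hu : u ∈ (ofResolvent R).form.dom,
        ((ofResolvent R).form.toFun ⟨u, hu⟩ ⟨u, hu⟩).re + ‖u‖ ^ 2 ≤ c) ↔
      ∀ x, ‖inner ℂ u x‖ ^ 2 ≤ c * (inner ℂ x (R x)).re := by
  obtain ⟨N, _, J, hJ, hR⟩ := exists_form_isRepresentedBy h0 h1
  rw [hJ.le_iff hc, hR]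

/-- For the forward direction, Cauchy–Schwarz shows that `u = R' x` meets the variational bound for
`R'` with `c = (x, R' x)`. The form inequality transfers the bound to `R`; evaluated at `x` it reads
`(x, R' x)² ≤ (x, R' x) (x, R x)`, and `(x, R' x)` cancels unless it is zero. -/
theorem formLE_ofResolvent_iff {R R' : H →L[ℂ] H} (h0 : 0 ≤ R) (h1 : R ≤ 1) (h0' : 0 ≤ R')
    (h1' : R' ≤ 1) : (ofResolvent R).FormLE (ofResolvent R') ↔ R' ≤ R := by
  rw [formLE_iff_form]
  constructor
  · intro h
    refine le_of_re_inner_le h0' h0 fun x => ?_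
    have hc : 0 ≤ (inner ℂ x (R' x)).re :=
      ((ContinuousLinearMap.nonneg_iff_isPositive _).1 h0').re_inner_nonneg_right x
    have hx' (x : H) : (inner ℂ x (R' x)).re = ‖CFC.sqrt R' x‖ ^ 2 := by
      rw [← inner_sqrt_apply_sqrt_apply h0']
      exact inner_self_eq_norm_sq (𝕜 := ℂ) _
    obtain ⟨hu, hle⟩ := (form_le_iff h0' h1' (u := R' x) hc).2 fun y => by
      rw [← inner_conj_symm, ← inner_sqrt_apply_sqrt_apply h0', hx', hx', RCLike.norm_conj,
        ← mul_pow, mul_comm]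
      gcongr
      exact norm_inner_le_norm _ _
    obtain ⟨hu', hle'⟩ := h _ hu
    have h2 := (form_le_iff h0 h1 (u := R' x) hc).1 ⟨hu', by linarith⟩ x
    rw [← inner_conj_symm, RCLike.norm_conj] at h2
    rcases hc.eq_or_lt with h3 | h3
    · rw [← h3]
      exact ((ContinuousLinearMap.nonneg_iff_isPositive _).1 h0).re_inner_nonneg_right x
    · have h4 := (Complex.re_le_norm (inner ℂ x (R' x)))
      nlinarith
  · intro h u hu
    obtain ⟨N, _, J, hJ, hR⟩ := exists_form_isRepresentedBy h0 h1
    obtain ⟨N', _, J', hJ', hR'⟩ := exists_form_isRepresentedBy h0' h1'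
    exact hJ.dom_le_and_le hJ' (fun x => by rw [hR, hR']; exact re_inner_le_of_le h x) hu

theorem IsNonnegSelfAdjoint.inv {A : LinRel H} (hA : A.IsNonnegSelfAdjoint) :
    A.inv.IsNonnegSelfAdjoint := by
  obtain ⟨R, h0, h1, rfl⟩ := hA.exists_eq_ofResolvent
  rw [inv_ofResolvent]
  exact isNonnegSelfAdjoint_ofResolvent (sub_nonneg.2 h1) (sub_le_self _ h0)

/-- Inversion is antitone for the form order. -/
theorem FormLE.inv {A B : LinRel H} (hA : A.IsNonnegSelfAdjoint) (hB : B.IsNonnegSelfAdjoint)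
    (h : A.FormLE B) : B.inv.FormLE A.inv := by
  obtain ⟨R, h0, h1, rfl⟩ := hA.exists_eq_ofResolvent
  obtain ⟨R', h0', h1', rfl⟩ := hB.exists_eq_ofResolvent
  rw [inv_ofResolvent, inv_ofResolvent, formLE_ofResolvent_iff (sub_nonneg.2 h1')
    (sub_le_self _ h0') (sub_nonneg.2 h1) (sub_le_self _ h0)]
  exact sub_le_sub_left ((formLE_ofResolvent_iff h0 h1 h0' h1').1 h) 1

/-- Both sides are the range of `(1 - R)^{1/2}`, because `1 - R` is the resolvent of `A⁻¹`. -/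
theorem IsNonnegSelfAdjoint.ran_sqrt {A : LinRel H} (hA : A.IsNonnegSelfAdjoint) :
    A.sqrt.ran = A.inv.form.dom := by
  obtain ⟨R, h0, h1, rfl⟩ := hA.exists_eq_ofResolvent
  have h0' := sub_nonneg.2 h1
  have h1' := sub_le_self 1 h0
  rw [ran_sqrt_ofResolvent h0 h1, inv_ofResolvent]
  ext u
  rw [mem_form_dom, sqrt_ofResolvent h0' h1']
  constructor
  · rintro ⟨x, rfl⟩
    obtain ⟨g, hg, -⟩ := (isNonnegSelfAdjoint_sqrtOfResolvent h0' h1').exists_mem_opPart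
      (p := (CFC.sqrt (1 - R) x, CFC.sqrt (1 - (1 - R)) x)) (mem_ofPair.2 ⟨x, rfl, rfl⟩)
    exact ⟨g, hg⟩
  · rintro ⟨g, hg⟩
    obtain ⟨x, hx, -⟩ := mem_ofPair.1 (mem_opPart.1 hg).1
    exact ⟨x, hx⟩

end LinRel

/-! ### Forms of closed operators -/

namespace SesqForm

variable {H : Type*} [NormedAddCommGroup H] [InnerProductSpace ℂ H] [CompleteSpace H]

/-- The form `(T ·, T ·)` of a closed operator `T` with graph `Γ` is the form of the nonnegative
selfadjoint relation associated with it. -/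
theorem toRel_of_isClosed {a : SesqForm H} {G : Type*} [NormedAddCommGroup G]
    [InnerProductSpace ℂ G] [CompleteSpace G] (Γ : Submodule ℂ (H × G))
    (hΓ : IsClosed (Γ : Set (H × G))) (hop : ∀ g, ((0 : H), g) ∈ Γ → g = 0)
    (hdom : ∀ u, u ∈ a.dom ↔ ∃ g, (u, g) ∈ Γ)
    (happ : ∀ u v g k (hu : u ∈ a.dom) (hv : v ∈ a.dom), (u, g) ∈ Γ → (v, k) ∈ Γ →
      a.toFun ⟨u, hu⟩ ⟨v, hv⟩ = inner ℂ g k) :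
    a.toRel.IsNonnegSelfAdjoint ∧ a.toRel.form = a := by
  -- With the Hilbert norm on the product, the inner product of the graph is `a[·,·] + (·,·)`, so
  -- the first projection represents `a`.
  let K : Submodule ℂ (WithLp 2 (H × G)) :=
    Γ.comap (WithLp.linearEquiv 2 ℂ (H × G)).toLinearMap
  have hK : IsClosed (K : Set (WithLp 2 (H × G))) :=
    hΓ.preimage (WithLp.prod_continuous_ofLp 2 H G)
  have : CompleteSpace K := hK.completeSpace_coe
  let J : K →L[ℂ] H := (ContinuousLinearMap.fst ℂ H G).comp
    ((WithLp.prodContinuousLinearEquiv 2 ℂ H G : WithLp 2 (H × G) →L[ℂ] H × G).comp K.subtypeL)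
  have hinner (x y : K) : inner ℂ x y = inner ℂ (J x) (J y) + inner ℂ x.1.snd y.1.snd := rfl
  have hmem (x : K) : (J x, x.1.snd) ∈ Γ := x.2
  have ha : a.IsRepresentedBy J := by
    refine ⟨?_, ?_, ?_, ?_⟩
    · refine (injective_iff_map_eq_zero _).2 fun x hx => ?_
      have h := hmem x
      rw [hx] at h
      have h2 := hinner x x
      rw [hx, hop _ h, inner_zero_left, inner_zero_left, add_zero] at h2
      exact inner_self_eq_zero.1 h2
    · ext u
      rw [hdom]
      constructor
      · rintro ⟨g, hg⟩
        exact ⟨⟨WithLp.toLp 2 (u, g), hg⟩, rfl⟩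
      · rintro ⟨x, rfl⟩
        exact ⟨_, hmem x⟩
    · intro x
      have h := congrArg Complex.re (hinner x x)
      have e1 : (inner ℂ x x).re = ‖x‖ ^ 2 := inner_self_eq_norm_sq (𝕜 := ℂ) x
      have e2 : (inner ℂ (J x) (J x)).re = ‖J x‖ ^ 2 := inner_self_eq_norm_sq (𝕜 := ℂ) (J x)
      have e3 : 0 ≤ (inner ℂ x.1.snd x.1.snd).re := inner_self_nonneg (𝕜 := ℂ)
      rw [Complex.add_re, e1, e2] at h
      exact (sq_le_sq₀ (norm_nonneg _) (norm_nonneg _)).1 (by linarith)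
    · intro x y hx hy
      rw [happ _ _ _ _ hx hy (hmem x) (hmem y), hinner, add_comm]
  have h0 := nonneg_comp_adjoint J
  have h1 := ha.comp_adjoint_le_one
  rw [ha.toRel_eq]
  refine ⟨LinRel.isNonnegSelfAdjoint_ofResolvent h0 h1, ?_⟩
  -- The form of the resulting relation has its own representing map, but with the same product `J
  -- J†`, and that product determines the form.
  obtain ⟨N, _, J', hJ', hR⟩ := LinRel.exists_form_isRepresentedBy h0 h1
  exact hJ'.eq_of_comp_adjoint_eq ha hR

end SesqForm

/-! ### Algebra of forms -/

namespace SesqForm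

variable {H : Type*} [NormedAddCommGroup H] [InnerProductSpace ℂ H]

theorem add_comm (a b : SesqForm H) : a.add b = b.add a :=
  ext_quadratic (inf_comm _ _) fun _ _ _ => _root_.add_comm _ _

theorem add_assoc (a b c : SesqForm H) : (a.add b).add c = a.add (b.add c) :=
  ext_quadratic (inf_assoc _ _ _) fun _ _ _ => _root_.add_assoc _ _ _

/-- The multiple of a form by a real number. -/
def smul (c : ℝ) (a : SesqForm H) : SesqForm H where
  dom := a.dom
  toFun := (c : ℂ) • a.toFun

theorem smul_add (c : ℝ) (a b : SesqForm H) : (a.add b).smul c = (a.smul c).add (b.smul c) :=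
  ext_quadratic rfl fun _ _ _ => mul_add _ _ _

theorem IsRestrictionOf.add_eq {a b : SesqForm H} (h : a.IsRestrictionOf b) :
    a.add b = a.smul 2 := by
  obtain ⟨hle, heq⟩ := h
  refine ext_quadratic (inf_eq_left.2 hle) fun u hu hu' => ?_
  have h1 := heq ⟨u, hu'⟩
  change a.toFun ⟨u, hu'⟩ ⟨u, hu'⟩ + b.toFun ⟨u, hle hu'⟩ ⟨u, hle hu'⟩ =
    ((2 : ℝ) : ℂ) * a.toFun ⟨u, hu'⟩ ⟨u, hu'⟩
  change a.toFun ⟨u, hu'⟩ ⟨u, hu'⟩ = b.toFun ⟨u, hle hu'⟩ ⟨u, hle hu'⟩ at h1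
  rw [← h1]
  push_cast
  ring

theorem toRel_smul {c : ℝ} (hc : c ≠ 0) (a : SesqForm H) :
    (a.smul c).toRel = a.toRel.scale c := by
  have hc' : (c : ℂ) ≠ 0 := by exact_mod_cast hc
  ext ⟨f, g⟩
  rw [LinRel.mem_scale_iff hc]
  refine exists_congr fun hf => forall_congr' fun ψ => ?_
  change (c : ℂ) * a.toFun ψ ⟨f, hf⟩ = inner ℂ (ψ : H) g ↔
    a.toFun ψ ⟨f, hf⟩ = inner ℂ (ψ : H) (((c⁻¹ : ℝ) : ℂ) • g)
  rw [inner_smul_right, Complex.ofReal_inv, eq_inv_mul_iff_mul_eq₀ hc']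

end SesqForm

/-! ### Form sums and the algebraic properties of the parallel sum -/

namespace LinRel

variable {H : Type*} [NormedAddCommGroup H] [InnerProductSpace ℂ H]

theorem formSum_comm (A B : LinRel H) : A.formSum B = B.formSum A := by
  rw [formSum, formSum, SesqForm.add_comm]

theorem parallelSum_comm (A B : LinRel H) : A.parallelSum B = B.parallelSum A := by
  rw [parallelSum, parallelSum, formSum_comm]

variable [CompleteSpace H]

/-- The sum of the forms is the form of the operator `u ↦ (A_o^{1/2} u, B_o^{1/2} u)` into `H ⊕ H`.
Its graph is the intersection of two preimages of closed graphs, hence closed. -/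
theorem formSum_spec {A B : LinRel H} (hA : A.IsNonnegSelfAdjoint) (hB : B.IsNonnegSelfAdjoint) :
    (A.formSum B).IsNonnegSelfAdjoint ∧ (A.formSum B).form = A.form.add B.form := by
  let Γ : Submodule ℂ (H × WithLp 2 (H × H)) :=
    { carrier := {p | (p.1, p.2.fst) ∈ A.sqrt.opPart ∧ (p.1, p.2.snd) ∈ B.sqrt.opPart}
      zero_mem' := ⟨A.sqrt.opPart.zero_mem, B.sqrt.opPart.zero_mem⟩
      add_mem' := fun h k => ⟨A.sqrt.opPart.add_mem h.1 k.1, B.sqrt.opPart.add_mem h.2 k.2⟩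
      smul_mem' := fun c _ h => ⟨A.sqrt.opPart.smul_mem c h.1, B.sqrt.opPart.smul_mem c h.2⟩ }
  refine SesqForm.toRel_of_isClosed Γ ?_ ?_ ?_ ?_
  · have h2 : Continuous fun p : H × WithLp 2 (H × H) => WithLp.ofLp p.2 :=
      (WithLp.prod_continuous_ofLp 2 H H).comp continuous_snd
    exact ((isClosed_opPart hA.isNonnegSelfAdjoint_sqrt).preimage
      (continuous_fst.prodMk (continuous_fst.comp h2))).inter
      ((isClosed_opPart hB.isNonnegSelfAdjoint_sqrt).preimage
      (continuous_fst.prodMk (continuous_snd.comp h2)))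
  · rintro g ⟨h1, h2⟩
    have e1 := eq_zero_of_mem_opPart h1
    have e2 := eq_zero_of_mem_opPart h2
    exact (WithLp.equiv 2 (H × H)).injective (Prod.ext e1 e2)
  · intro u
    constructor
    · rintro ⟨h1, h2⟩
      obtain ⟨g, hg⟩ := mem_form_dom.1 h1
      obtain ⟨k, hk⟩ := mem_form_dom.1 h2
      exact ⟨WithLp.toLp 2 (g, k), hg, hk⟩
    · rintro ⟨g, h1, h2⟩
      exact ⟨mem_form_dom.2 ⟨_, h1⟩, mem_form_dom.2 ⟨_, h2⟩⟩
  · intro u v g k hu hv h1 h2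
    exact congrArg₂ (· + ·) (form_apply hu.1 hv.1 h1.1 h2.1) (form_apply hu.2 hv.2 h1.2 h2.2)

theorem IsNonnegSelfAdjoint.formSum {A B : LinRel H} (hA : A.IsNonnegSelfAdjoint)
    (hB : B.IsNonnegSelfAdjoint) : (A.formSum B).IsNonnegSelfAdjoint :=
  (formSum_spec hA hB).1

theorem form_formSum {A B : LinRel H} (hA : A.IsNonnegSelfAdjoint)
    (hB : B.IsNonnegSelfAdjoint) : (A.formSum B).form = A.form.add B.form :=
  (formSum_spec hA hB).2

theorem IsNonnegSelfAdjoint.parallelSum {A B : LinRel H} (hA : A.IsNonnegSelfAdjoint)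
    (hB : B.IsNonnegSelfAdjoint) : (A.parallelSum B).IsNonnegSelfAdjoint :=
  (hA.inv.formSum hB.inv).inv

/-- The form `c A[·,·]` is that of the closed operator `√c A_o^{1/2}`, and its associated relation
is `c A`. -/
theorem form_scale {A : LinRel H} (hA : A.IsNonnegSelfAdjoint) {c : ℝ} (hc : 0 < c) :
    (A.scale c).form = A.form.smul c := by
  have hs : ((√c : ℝ) : ℂ) ≠ 0 := by exact_mod_cast (Real.sqrt_pos.2 hc).ne'
  have hm {p : H × H} : p ∈ A.sqrt.opPart.scale √c ↔ ∃ g, (p.1, g) ∈ A.sqrt.opPart ∧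
      ((√c : ℝ) : ℂ) • g = p.2 := mem_scale
  have h := SesqForm.toRel_of_isClosed (a := A.form.smul c) (A.sqrt.opPart.scale √c) ?_ ?_ ?_ ?_
  · rw [SesqForm.toRel_smul hc.ne', hA.toRel_form] at h
    exact h.2
  · have : (A.sqrt.opPart.scale √c : Set (H × H)) =
        (fun p : H × H => (p.1, (((√c)⁻¹ : ℝ) : ℂ) • p.2)) ⁻¹' A.sqrt.opPart := by
      ext p
      exact mem_scale_iff (Real.sqrt_pos.2 hc).ne'
    rw [this]
    exact (isClosed_opPart hA.isNonnegSelfAdjoint_sqrt).preimage (by fun_prop)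
  · intro g hg
    obtain ⟨k, hk, rfl⟩ := hm.1 hg
    rw [eq_zero_of_mem_opPart hk, smul_zero]
  · intro u
    refine (mem_form_dom (A := A)).trans ⟨?_, ?_⟩
    · rintro ⟨g, hg⟩
      exact ⟨_, hm.2 ⟨g, hg, rfl⟩⟩
    · rintro ⟨g, hg⟩
      obtain ⟨k, hk, -⟩ := hm.1 hg
      exact ⟨k, hk⟩
  · intro u v g k hu hv hg hk
    obtain ⟨g, hg, rfl⟩ := hm.1 hg
    obtain ⟨k, hk, rfl⟩ := hm.1 hk
    rw [inner_smul_left, inner_smul_right, Complex.conj_ofReal, ← mul_assoc,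
      ← Complex.ofReal_mul, Real.mul_self_sqrt hc.le, ← form_apply hu hv hg hk]
    rfl

theorem formSum_scale {A B : LinRel H} (hA : A.IsNonnegSelfAdjoint) (hB : B.IsNonnegSelfAdjoint)
    {c : ℝ} (hc : 0 < c) : (A.scale c).formSum (B.scale c) = (A.formSum B).scale c := by
  rw [formSum, form_scale hA hc, form_scale hB hc, ← SesqForm.smul_add,
    SesqForm.toRel_smul hc.ne', formSum]

theorem parallelSum_scale {A B : LinRel H} (hA : A.IsNonnegSelfAdjoint)
    (hB : B.IsNonnegSelfAdjoint) {c : ℝ} (hc : 0 < c) :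
    (A.scale c).parallelSum (B.scale c) = (A.parallelSum B).scale c := by
  rw [parallelSum, inv_scale hc.ne', inv_scale hc.ne', formSum_scale hA.inv hB.inv (inv_pos.2 hc),
    inv_scale (inv_ne_zero hc.ne'), _root_.inv_inv, parallelSum]

theorem formSum_assoc {A B C : LinRel H} (hA : A.IsNonnegSelfAdjoint)
    (hB : B.IsNonnegSelfAdjoint) (hC : C.IsNonnegSelfAdjoint) :
    (A.formSum B).formSum C = A.formSum (B.formSum C) := by
  rw [formSum, form_formSum hA hB, SesqForm.add_assoc, ← form_formSum hB hC, ← formSum]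

theorem formSum_formSum {A B C : LinRel H} (hA : A.IsNonnegSelfAdjoint)
    (hB : B.IsNonnegSelfAdjoint) : (A.formSum B).formSum C = A.formSum₃ B C := by
  rw [formSum, form_formSum hA hB, formSum₃]

theorem formLE_formSum_left {A B : LinRel H} (hA : A.IsNonnegSelfAdjoint)
    (hB : B.IsNonnegSelfAdjoint) : A.FormLE (A.formSum B) := by
  rw [formLE_iff_form, form_formSum hA hB]
  rintro u ⟨hu, hu'⟩
  refine ⟨hu, ?_⟩
  change _ ≤ (A.form.toFun ⟨u, hu⟩ ⟨u, hu⟩ + B.form.toFun ⟨u, hu'⟩ ⟨u, hu'⟩).re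
  have h : 0 ≤ (B.form.toFun ⟨u, hu'⟩ ⟨u, hu'⟩).re :=
    (sq_nonneg _).trans_eq (re_form_apply_self hu').symm
  rw [Complex.add_re]
  linarith

theorem FormLE.formSum {A₁ A₂ B₁ B₂ : LinRel H} (hA₁ : A₁.IsNonnegSelfAdjoint)
    (hA₂ : A₂.IsNonnegSelfAdjoint) (hB₁ : B₁.IsNonnegSelfAdjoint) (hB₂ : B₂.IsNonnegSelfAdjoint)
    (hA : A₁.FormLE A₂) (hB : B₁.FormLE B₂) : (A₁.formSum B₁).FormLE (A₂.formSum B₂) := by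
  rw [formLE_iff_form] at hA hB ⊢
  rw [form_formSum hA₁ hB₁, form_formSum hA₂ hB₂]
  rintro u ⟨hu, hu'⟩
  obtain ⟨h1, h2⟩ := hA u hu
  obtain ⟨h3, h4⟩ := hB u hu'
  exact ⟨⟨h1, h3⟩, add_le_add h2 h4⟩

theorem parallelSum_formLE_left {A B : LinRel H} (hA : A.IsNonnegSelfAdjoint)
    (hB : B.IsNonnegSelfAdjoint) : (A.parallelSum B).FormLE A := by
  have h := (formLE_formSum_left hA.inv hB.inv).inv hA.inv (hA.inv.formSum hB.inv)
  rwa [inv_inv] at h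

theorem FormLE.parallelSum {A₁ A₂ B : LinRel H} (hA₁ : A₁.IsNonnegSelfAdjoint)
    (hA₂ : A₂.IsNonnegSelfAdjoint) (hB : B.IsNonnegSelfAdjoint) (hA : A₁.FormLE A₂) :
    (A₁.parallelSum B).FormLE (A₂.parallelSum B) :=
  FormLE.inv (hA₂.inv.formSum hB.inv) (hA₁.inv.formSum hB.inv)
    ((FormLE.inv hA₁ hA₂ hA).formSum hA₂.inv hA₁.inv hB.inv hB.inv (FormLE.refl _))

theorem ran_sqrt_parallelSum {A B : LinRel H} (hA : A.IsNonnegSelfAdjoint)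
    (hB : B.IsNonnegSelfAdjoint) :
    (A.parallelSum B).sqrt.ran = A.sqrt.ran ⊓ B.sqrt.ran := by
  rw [(hA.parallelSum hB).ran_sqrt, hA.ran_sqrt, hB.ran_sqrt, parallelSum, inv_inv,
    form_formSum hA.inv hB.inv]
  rfl

/-- Both conditions say that `1 - R = 0`. -/
theorem IsNonnegSelfAdjoint.eq_zeroRel_iff {A : LinRel H} (hA : A.IsNonnegSelfAdjoint) :
    A = zeroRel ↔ A.sqrt.ran = ⊥ := by
  obtain ⟨R, h0, h1, rfl⟩ := hA.exists_eq_ofResolvent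
  have h0' := sub_nonneg.2 h1
  rw [ran_sqrt_ofResolvent h0 h1, zeroRel_eq_ofResolvent, LinearMap.range_eq_bot]
  constructor
  · intro h
    rw [ofResolvent_injective h, sub_self, CFC.sqrt_zero]
    rfl
  · intro h
    have h2 : CFC.sqrt (1 - R) = 0 := by
      ext x
      exact congrArg (fun T : H →ₗ[ℂ] H => T x) h
    rw [sub_eq_zero.1 ((CFC.sqrt_eq_zero_iff _ h0').1 h2)]

/-- On `D[A⁻¹]` the two forms coincide, so their sum is `2 A⁻¹[·,·]` and `A : B = (2 A⁻¹)⁻¹ = A /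
2`. -/
theorem harmonicMean_eq_left {A B : LinRel H} (hA : A.IsNonnegSelfAdjoint)
    (h : A.inv.form.IsRestrictionOf B.inv.form) : A.harmonicMean B = A := by
  rw [harmonicMean, parallelSum, formSum, h.add_eq, SesqForm.toRel_smul two_ne_zero,
    hA.inv.toRel_form, inv_scale two_ne_zero, inv_inv,
    scale_scale (inv_ne_zero two_ne_zero) two_ne_zero, mul_inv_cancel₀ two_ne_zero, scale_one]

end LinRel

/-! ### Monotone sequences of bounded operators and shifted resolvents -/

section Operators

variable {H : Type*} [NormedAddCommGroup H] [InnerProductSpace ℂ H] [CompleteSpace H]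

/-- This is `D² ≤ D`. Applied to differences of a monotone sequence, it turns convergence of the
quadratic forms into strong convergence. -/
theorem ContinuousLinearMap.norm_apply_sq_le_re_inner {D : H →L[ℂ] H} (h0 : 0 ≤ D) (h1 : D ≤ 1)
    (x : H) : ‖D x‖ ^ 2 ≤ (inner ℂ x (D x)).re := by
  have e (x : H) : (inner ℂ x (D x)).re = ‖CFC.sqrt D x‖ ^ 2 := by
    rw [← LinRel.inner_sqrt_apply_sqrt_apply h0]
    exact inner_self_eq_norm_sq (𝕜 := ℂ) _
  have h := LinRel.re_inner_le_of_le h1 (CFC.sqrt D x)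
  rw [e, LinRel.sqrt_apply_sqrt_apply h0] at h
  rw [e]
  exact h.trans_eq (inner_self_eq_norm_sq (𝕜 := ℂ) _)

/-- A decreasing sequence of operators between `0` and `1` converges strongly. -/
theorem ContinuousLinearMap.exists_tendsto_of_antitone {R : ℕ → H →L[ℂ] H} (h0 : ∀ n, 0 ≤ R n)
    (h1 : ∀ n, R n ≤ 1) (hR : Antitone R) :
    ∃ R' : H →L[ℂ] H, ∀ x, Tendsto (fun n => R n x) atTop (𝓝 (R' x)) := by
  have hdiff {m n : ℕ} (hmn : m ≤ n) (x : H) :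
      ‖R m x - R n x‖ ^ 2 ≤ (inner ℂ x (R m x)).re - (inner ℂ x (R n x)).re := by
    have h := norm_apply_sq_le_re_inner (sub_nonneg.2 (hR hmn))
      ((sub_le_self _ (h0 n)).trans (h1 m)) x
    change ‖R m x - R n x‖ ^ 2 ≤ (inner ℂ x (R m x - R n x)).re at h
    rwa [inner_sub_right, Complex.sub_re] at h
  have hex (x : H) : ∃ y, Tendsto (fun n => R n x) atTop (𝓝 y) := by
    apply cauchySeq_tendsto_of_complete
    have hanti : Antitone fun n => (inner ℂ x (R n x)).re :=
      fun m n hmn => LinRel.re_inner_le_of_le (hR hmn) x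
    have hbdd : BddBelow (Set.range fun n => (inner ℂ x (R n x)).re) :=
      ⟨0, by
        rintro _ ⟨n, rfl⟩
        exact ((nonneg_iff_isPositive _).1 (h0 n)).re_inner_nonneg_right x⟩
    have hc := (tendsto_atTop_ciInf hanti hbdd).cauchySeq
    rw [Metric.cauchySeq_iff'] at hc ⊢
    intro ε hε
    obtain ⟨N, hN⟩ := hc (ε ^ 2) (by positivity)
    refine ⟨N, fun n hn => ?_⟩
    have h2 := hN n hn
    rw [dist_comm, Real.dist_eq] at h2
    rw [dist_comm, dist_eq_norm]
    exact lt_of_pow_lt_pow_left₀ 2 hε.le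
      ((hdiff hn x).trans_lt ((le_abs_self _).trans_lt h2))
  choose f hf using hex
  exact ⟨continuousLinearMapOfTendsto R (tendsto_pi_nhds.2 hf), hf⟩

/-- `R (1 + ε R)⁻¹`, the resolvent of `A + ε I` if `R` is the resolvent of `A`. -/
theorem ContinuousLinearMap.exists_shifted_resolvent {R : H →L[ℂ] H} (h0 : 0 ≤ R) :
    ∃ Y : ℝ → H →L[ℂ] H, (∀ ε, 0 ≤ ε → 0 ≤ Y ε ∧ Y ε ≤ R ∧ Y ε + (ε : ℂ) • (R * Y ε) = R ∧
      Commute R (Y ε)) ∧ ∀ δ ε, 0 ≤ δ → δ ≤ ε → Y ε ≤ Y δ := by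
  have hsa : IsSelfAdjoint R := IsSelfAdjoint.of_nonneg h0
  have hspec {x : ℝ} (hx : x ∈ spectrum ℝ R) : 0 ≤ x := spectrum_nonneg_of_nonneg h0 hx
  have hpos {ε x : ℝ} (hε : 0 ≤ ε) (hx : x ∈ spectrum ℝ R) : 0 < 1 + ε * x := by
    have := mul_nonneg hε (hspec hx)
    linarith
  have hcont {ε : ℝ} (hε : 0 ≤ ε) : ContinuousOn (fun x : ℝ => x / (1 + ε * x)) (spectrum ℝ R) :=
    continuousOn_id.div (by fun_prop) fun x hx => (hpos hε hx).ne'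
  -- The functional calculus reduces each claim to a scalar one on the spectrum, where `x ≥ 0` keeps
  -- the denominator positive.
  refine ⟨fun ε => cfc (fun x : ℝ => x / (1 + ε * x)) R, fun ε hε => ⟨?_, ?_, ?_, ?_⟩, ?_⟩
  · exact cfc_nonneg fun x hx => div_nonneg (hspec hx) (hpos hε hx).le
  · conv_rhs => rw [← cfc_id' ℝ R]
    refine cfc_mono (fun x hx => ?_) (hcont hε) (by fun_prop)
    refine div_le_self (hspec hx) ?_
    have := mul_nonneg hε (hspec hx)
    linarith
  · have hcont' : ContinuousOn (fun x : ℝ => x * (x / (1 + ε * x))) (spectrum ℝ R) :=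
      continuousOn_id.mul (hcont hε)
    have hcont'' : ContinuousOn (fun x : ℝ => ε * (x * (x / (1 + ε * x)))) (spectrum ℝ R) :=
      continuousOn_const.mul hcont'
    have h : R * cfc (fun x : ℝ => x / (1 + ε * x)) R =
        cfc (fun x : ℝ => x * (x / (1 + ε * x))) R := by
      rw [cfc_mul (fun x : ℝ => x) _ R (by fun_prop) (hcont hε), cfc_id' ℝ R]
    have h2 : (ε : ℂ) • (R * cfc (fun x : ℝ => x / (1 + ε * x)) R) =
        cfc (fun x : ℝ => ε * (x * (x / (1 + ε * x)))) R := by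
      rw [h, cfc_const_mul ε _ R hcont']
      rfl
    rw [h2, ← cfc_add R _ _ (hcont hε) hcont'']
    conv_rhs => rw [← cfc_id' ℝ R]
    refine cfc_congr fun x hx => ?_
    have := (hpos hε hx).ne'
    calc x / (1 + ε * x) + ε * (x * (x / (1 + ε * x)))
        = x * ((1 + ε * x) / (1 + ε * x)) := by ring
      _ = x := by rw [div_self this, mul_one]
  · have h := cfc_commute_cfc (fun x : ℝ => x) (fun x : ℝ => x / (1 + ε * x)) R
    rwa [cfc_id' ℝ R] at h
  · intro δ ε hδ hδε
    refine cfc_mono (fun x hx => ?_) (hcont (hδ.trans hδε)) (hcont hδ)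
    have := hspec hx
    have := hpos hδ hx
    gcongr

end Operators

/-! ### Monotone convergence of form sums -/

namespace LinRel

variable {H : Type*} [NormedAddCommGroup H] [InnerProductSpace ℂ H]

theorem addScalar_ofResolvent {R Y : H →L[ℂ] H} {ε : ℝ} (h : Y + (ε : ℂ) • (R * Y) = R)
    (hc : Commute R Y) : (ofResolvent R).addScalar ε = ofResolvent Y := by
  have h1 (x : H) : Y x + (ε : ℂ) • R (Y x) = R x := congrArg (fun T : H →L[ℂ] H => T x) h
  have h2 (x : H) : R (Y x) = Y (R x) := congrArg (fun T : H →L[ℂ] H => T x) hc.eq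
  ext ⟨f, g⟩
  rw [mem_addScalar, mem_ofResolvent, mem_ofResolvent]
  dsimp only
  constructor
  · intro hf
    have h3 := h1 (f + (g - (ε : ℂ) • f))
    rw [h2, ← hf, ← map_smul, ← map_add] at h3
    rw [← h3, h3]
    exact h3.symm.trans (congrArg Y (by abel))
  · intro hf
    have h3 := h1 (f + g)
    rw [← hf] at h3
    rw [← add_sub_assoc, map_sub, map_smul, ← h3, add_sub_cancel_right]

variable [CompleteSpace H]

/-- Nondecreasing strong resolvent convergence is inherited by form sums. -/
theorem tendsto_formSum {P Q R : ℕ → H →L[ℂ] H} {P' Q' R' : H →L[ℂ] H}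
    (hP0 : ∀ n, 0 ≤ P n) (hP1 : ∀ n, P n ≤ 1) (hP : Antitone P) (hP0' : 0 ≤ P') (hP1' : P' ≤ 1)
    (hPP' : ∀ n, P' ≤ P n) (hPlim : ∀ x, Tendsto (fun n => P n x) atTop (𝓝 (P' x)))
    (hQ0 : ∀ n, 0 ≤ Q n) (hQ1 : ∀ n, Q n ≤ 1) (hQ : Antitone Q) (hQ0' : 0 ≤ Q') (hQ1' : Q' ≤ 1)
    (hQQ' : ∀ n, Q' ≤ Q n) (hQlim : ∀ x, Tendsto (fun n => Q n x) atTop (𝓝 (Q' x)))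
    (hR0 : ∀ n, 0 ≤ R n) (hR1 : ∀ n, R n ≤ 1) (hR0' : 0 ≤ R') (hR1' : R' ≤ 1)
    (hR : ∀ n, (ofResolvent (P n)).formSum (ofResolvent (Q n)) = ofResolvent (R n))
    (hR' : (ofResolvent P').formSum (ofResolvent Q') = ofResolvent R') (x : H) :
    Tendsto (fun n => R n x) atTop (𝓝 (R' x)) := by
  have hnP (n : ℕ) := isNonnegSelfAdjoint_ofResolvent (hP0 n) (hP1 n)
  have hnQ (n : ℕ) := isNonnegSelfAdjoint_ofResolvent (hQ0 n) (hQ1 n)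
  have hnP' := isNonnegSelfAdjoint_ofResolvent hP0' hP1'
  have hnQ' := isNonnegSelfAdjoint_ofResolvent hQ0' hQ1'
  have hanti : Antitone R := fun m n hmn => by
    rw [← formLE_ofResolvent_iff (hR0 m) (hR1 m) (hR0 n) (hR1 n), ← hR, ← hR]
    exact FormLE.formSum (hnP m) (hnP n) (hnQ m) (hnQ n)
      ((formLE_ofResolvent_iff (hP0 m) (hP1 m) (hP0 n) (hP1 n)).2 (hP hmn))
      ((formLE_ofResolvent_iff (hQ0 m) (hQ1 m) (hQ0 n) (hQ1 n)).2 (hQ hmn))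
  have hle (n : ℕ) : R' ≤ R n := by
    rw [← formLE_ofResolvent_iff (hR0 n) (hR1 n) hR0' hR1', ← hR, ← hR']
    exact FormLE.formSum (hnP n) hnP' (hnQ n) hnQ'
      ((formLE_ofResolvent_iff (hP0 n) (hP1 n) hP0' hP1').2 (hPP' n))
      ((formLE_ofResolvent_iff (hQ0 n) (hQ1 n) hQ0' hQ1').2 (hQQ' n))
  obtain ⟨S, hS⟩ := ContinuousLinearMap.exists_tendsto_of_antitone hR0 hR1 hanti
  have hre {T : ℕ → H →L[ℂ] H} {T' : H →L[ℂ] H}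
      (hT : ∀ x, Tendsto (fun n => T n x) atTop (𝓝 (T' x))) (x : H) :
      Tendsto (fun n => (inner ℂ x (T n x)).re) atTop (𝓝 (inner ℂ x (T' x)).re) :=
    (Complex.continuous_re.tendsto _).comp (tendsto_const_nhds.inner (hT x))
  have hS0 : 0 ≤ S := by
    rw [ContinuousLinearMap.nonneg_iff_isPositive]
    refine ⟨fun x y => ?_, fun x => ?_⟩
    · refine tendsto_nhds_unique ((hS x).inner tendsto_const_nhds)
        ((tendsto_const_nhds.inner (hS y)).congr fun n => ?_)
      exact (((ContinuousLinearMap.nonneg_iff_isPositive _).1 (hR0 n)).isSymmetric x y).symm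
    · refine ge_of_tendsto ((Complex.continuous_re.tendsto _).comp
        ((hS x).inner tendsto_const_nhds)) (Eventually.of_forall fun n => ?_)
      exact ((ContinuousLinearMap.nonneg_iff_isPositive _).1 (hR0 n)).re_inner_nonneg_left x
  have hSR (n : ℕ) : S ≤ R n := le_of_re_inner_le hS0 (hR0 n) fun x =>
    le_of_tendsto (hre hS x) (eventually_atTop.2 ⟨n, fun k hk => re_inner_le_of_le (hanti hk) x⟩)
  have hS1 : S ≤ 1 := (hSR 0).trans (hR1 0)
  have hR'S : R' ≤ S := le_of_re_inner_le hR0' hS0 fun x =>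
    ge_of_tendsto (hre hS x) (Eventually.of_forall fun n => re_inner_le_of_le (hle n) x)
  -- the form of a strong resolvent limit is dominated by the limit of the forms
  have hlsc {T : ℕ → H →L[ℂ] H} {T' : H →L[ℂ] H} (hT0 : ∀ n, 0 ≤ T n) (hT1 : ∀ n, T n ≤ 1)
      (hT0' : 0 ≤ T') (hT1' : T' ≤ 1)
      (hT : ∀ x, Tendsto (fun n => T n x) atTop (𝓝 (T' x))) {u : H} {t : ℝ} (ht : 0 ≤ t)
      (h : ∀ n, ∃ hu : u ∈ (ofResolvent (T n)).form.dom,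
        ((ofResolvent (T n)).form.toFun ⟨u, hu⟩ ⟨u, hu⟩).re ≤ t) :
      ∃ hu : u ∈ (ofResolvent T').form.dom,
        ((ofResolvent T').form.toFun ⟨u, hu⟩ ⟨u, hu⟩).re ≤ t := by
    obtain ⟨hu, h'⟩ := (form_le_iff hT0' hT1' (u := u) (c := t + ‖u‖ ^ 2) (by positivity)).2
      fun x => ge_of_tendsto ((hre hT x).const_mul _) (Eventually.of_forall fun n => by
        obtain ⟨hu, h'⟩ := h n
        exact (form_le_iff (hT0 n) (hT1 n) (by positivity)).1 ⟨hu, by linarith⟩ x)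
    exact ⟨hu, by linarith⟩
  -- In terms of forms, the limit form sum must be bounded by the form of `S`. Since `S ≤ R n`, the
  -- form of `S` dominates each approximating sum.
  have hSR' : S ≤ R' := by
    rw [← formLE_ofResolvent_iff hR0' hR1' hS0 hS1, ← hR', formLE_iff_form,
      form_formSum hnP' hnQ']
    intro u hu
    set c := ((ofResolvent S).form.toFun ⟨u, hu⟩ ⟨u, hu⟩).re with hc
    have hn (n : ℕ) : ∃ (h1 : u ∈ (ofResolvent (P n)).form.dom)
        (h2 : u ∈ (ofResolvent (Q n)).form.dom),
        ((ofResolvent (P n)).form.toFun ⟨u, h1⟩ ⟨u, h1⟩).re +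
          ((ofResolvent (Q n)).form.toFun ⟨u, h2⟩ ⟨u, h2⟩).re ≤ c := by
      have h := (formLE_ofResolvent_iff (hR0 n) (hR1 n) hS0 hS1).2 (hSR n)
      rw [← hR, formLE_iff_form, form_formSum (hnP n) (hnQ n)] at h
      obtain ⟨⟨h1, h2⟩, h3⟩ := h u hu
      exact ⟨h1, h2, h3⟩
    choose hp hq hpq using hn
    set p : ℕ → ℝ := fun n => ((ofResolvent (P n)).form.toFun ⟨u, hp n⟩ ⟨u, hp n⟩).re with hpdef
    set q : ℕ → ℝ := fun n => ((ofResolvent (Q n)).form.toFun ⟨u, hq n⟩ ⟨u, hq n⟩).re with hqdef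
    have hp0 (n : ℕ) : 0 ≤ p n := (sq_nonneg _).trans_eq (re_form_apply_self (hp n)).symm
    have hq0 (n : ℕ) : 0 ≤ q n := (sq_nonneg _).trans_eq (re_form_apply_self (hq n)).symm
    have hpmono : Monotone p := fun m n hmn =>
      (formLE_iff_form.1 ((formLE_ofResolvent_iff (hP0 m) (hP1 m) (hP0 n) (hP1 n)).2 (hP hmn))
        u (hp n)).2
    have hqmono : Monotone q := fun m n hmn =>
      (formLE_iff_form.1 ((formLE_ofResolvent_iff (hQ0 m) (hQ1 m) (hQ0 n) (hQ1 n)).2 (hQ hmn))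
        u (hq n)).2
    have hpb : BddAbove (Set.range p) := ⟨c, by
      rintro _ ⟨n, rfl⟩
      linarith [hpq n, hq0 n]⟩
    have hqb : BddAbove (Set.range q) := ⟨c, by
      rintro _ ⟨n, rfl⟩
      linarith [hpq n, hp0 n]⟩
    -- Both sequences increase, so `p n + q n ≤ c` passes to the sum of the suprema. Semicontinuity
    -- then bounds each limit form by its own supremum.
    have hsum : (⨆ n, p n) + ⨆ n, q n ≤ c :=
      le_of_tendsto ((tendsto_atTop_ciSup hpmono hpb).add (tendsto_atTop_ciSup hqmono hqb))
        (Eventually.of_forall hpq)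
    obtain ⟨h1, h2⟩ := hlsc hP0 hP1 hP0' hP1' hPlim ((hp0 0).trans (le_ciSup hpb 0))
      fun n => ⟨hp n, le_ciSup hpb n⟩
    obtain ⟨h3, h4⟩ := hlsc hQ0 hQ1 hQ0' hQ1' hQlim ((hq0 0).trans (le_ciSup hqb 0))
      fun n => ⟨hq n, le_ciSup hqb n⟩
    exact ⟨⟨h1, h3⟩, (add_le_add h2 h4).trans hsum⟩
  rw [le_antisymm hR'S hSR']
  exact hS x

end LinRel

/-! ### Approximation of the parallel sum -/

namespace LinRel

variable {H : Type*} [NormedAddCommGroup H] [InnerProductSpace ℂ H]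

theorem isNonnegSelfAdjoint_scale {A : LinRel H} (hA : A.IsNonnegSelfAdjoint) {c : ℝ}
    (hc : 0 < c) : (A.scale c).IsNonnegSelfAdjoint := by
  have hc' : (c : ℂ) ≠ 0 := by exact_mod_cast hc.ne'
  refine isNonnegSelfAdjoint_of_mem_iff (fun p => ?_) fun p hp => ?_
  · rw [mem_scale_iff hc.ne', hA.mem_iff]
    constructor
    · intro h q hq
      have := h _ ((mem_scale_iff hc.ne').1 hq)
      rw [inner_smul_left, inner_smul_right, Complex.conj_ofReal, Complex.ofReal_inv] at this
      exact mul_left_cancel₀ (inv_ne_zero hc') this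
    · intro h q hq
      have := h (q.1, (c : ℂ) • q.2) (mem_scale.2 ⟨q.2, hq, rfl⟩)
      rw [inner_smul_left, Complex.conj_ofReal] at this
      rw [inner_smul_right, ← this, Complex.ofReal_inv, inv_mul_cancel_left₀ hc']
  · obtain ⟨g, hg, h⟩ := mem_scale.1 hp
    rw [← h, inner_smul_right, Complex.re_ofReal_mul]
    exact mul_nonneg hc.le (hA.nonneg _ hg)

variable [CompleteSpace H]

/-- The ordinary sum is contained in the form sum. As it is defined on all of `H`, the multivalued
part of the form sum, being orthogonal to the domain, vanishes, and no further pairs fit. -/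
theorem add_eq_formSum {A B : LinRel H} (hA : A.IsNonnegSelfAdjoint) (hB : B.IsNonnegSelfAdjoint)
    (hA' : ∀ u, ∃ g, (u, g) ∈ A) (hB' : ∀ u, ∃ g, (u, g) ∈ B) : A.add B = A.formSum B := by
  have hF := hA.formSum hB
  have hle : A.add B ≤ A.formSum B := by
    rintro ⟨u, w⟩ ⟨f, g, hf, hg, rfl⟩
    rw [← hA.toRel_form] at hf
    rw [← hB.toRel_form] at hg
    obtain ⟨hu, hf⟩ := hf
    obtain ⟨hu', hg⟩ := hg
    refine ⟨⟨hu, hu'⟩, fun ψ => ?_⟩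
    rw [inner_add_right]
    exact congrArg₂ (· + ·) (hf ⟨ψ, ψ.2.1⟩) (hg ⟨ψ, ψ.2.2⟩)
  have hdom (u : H) : ∃ w, (u, w) ∈ A.add B := by
    obtain ⟨f, hf⟩ := hA' u
    obtain ⟨g, hg⟩ := hB' u
    exact ⟨f + g, f, g, hf, hg, rfl⟩
  refine le_antisymm hle ?_
  rintro ⟨u, w⟩ hw
  obtain ⟨w', hw'⟩ := hdom u
  have hm : w - w' ∈ (A.formSum B).mulPart := by
    have := (A.formSum B).sub_mem hw (hle hw')
    rwa [Prod.mk_sub_mk, sub_self] at this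
  obtain ⟨k, hk⟩ := hdom (w - w')
  have h0 := inner_self_eq_zero.1 (hF.inner_eq_zero_of_mem_mulPart (hle hk) hm)
  rwa [sub_eq_zero.1 h0]

/-- Surjectivity of `A + ε I` comes from that of `ε⁻¹ A + I`, applied to `ε⁻¹ u`. -/
theorem exists_mem_inv_addScalar {A : LinRel H} (hA : A.IsNonnegSelfAdjoint) {ε : ℝ} (hε : 0 < ε)
    (u : H) : ∃ g, (u, g) ∈ (A.addScalar ε).inv := by
  obtain ⟨R, -, -, hR⟩ :=
    (isNonnegSelfAdjoint_scale hA (inv_pos.2 hε)).exists_eq_ofResolvent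
  set v : H := ((ε⁻¹ : ℝ) : ℂ) • u with hv
  have h : ((R v, v - R v) : H × H) ∈ A.scale ε⁻¹ := by
    rw [hR, mem_ofResolvent]
    simp
  rw [mem_scale_iff (inv_ne_zero hε.ne'), _root_.inv_inv] at h
  refine ⟨R v, mem_inv.2 (mem_addScalar.2 ?_)⟩
  have h2 : (ε : ℂ) • (v - R v) = u - (ε : ℂ) • R v := by
    have hε' : (ε : ℂ) ≠ 0 := by exact_mod_cast hε.ne'
    rw [smul_sub, hv, smul_smul, Complex.ofReal_inv, mul_inv_cancel₀ hε', one_smul]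
  rwa [← h2]

/-- The resolvents of the increasing sequence `(A + I / (n + 1))⁻¹`. -/
theorem exists_resolvent_inv_addScalar {A : LinRel H} (hA : A.IsNonnegSelfAdjoint) :
    ∃ (P : ℕ → H →L[ℂ] H) (P' : H →L[ℂ] H),
      (∀ n : ℕ, (A.addScalar (1 / ((n : ℝ) + 1))).inv = ofResolvent (P n)) ∧
      A.inv = ofResolvent P' ∧ (∀ n, 0 ≤ P n) ∧ (∀ n, P n ≤ 1) ∧ Antitone P ∧ 0 ≤ P' ∧ P' ≤ 1 ∧
      (∀ n, P' ≤ P n) ∧ ∀ x, Tendsto (fun n => P n x) atTop (𝓝 (P' x)) := by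
  obtain ⟨R, h0, h1, rfl⟩ := hA.exists_eq_ofResolvent
  obtain ⟨Y, hY, hmono⟩ := ContinuousLinearMap.exists_shifted_resolvent h0
  have hε (n : ℕ) : (0 : ℝ) ≤ 1 / ((n : ℝ) + 1) := by positivity
  refine ⟨fun n => 1 - Y (1 / ((n : ℝ) + 1)), 1 - R, fun n => ?_, inv_ofResolvent R,
    fun n => sub_nonneg.2 ((hY _ (hε n)).2.1.trans h1), fun n => sub_le_self _ (hY _ (hε n)).1,
    fun m n hmn => sub_le_sub_left (hmono _ _ (hε n) (one_div_le_one_div_of_le (by positivity)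
      (by gcongr))) 1, sub_nonneg.2 h1, sub_le_self _ h0,
    fun n => sub_le_sub_left (hY _ (hε n)).2.1 1, fun x => ?_⟩
  · rw [addScalar_ofResolvent (hY _ (hε n)).2.2.1 (hY _ (hε n)).2.2.2, inv_ofResolvent]
  · refine Tendsto.sub tendsto_const_nhds ?_
    have hnorm {T : H →L[ℂ] H} (hT0 : 0 ≤ T) (hT1 : T ≤ 1) (y : H) : ‖T y‖ ≤ ‖y‖ := by
      refine (T.le_of_opNorm_le ?_ y).trans_eq (one_mul _)
      exact (CStarAlgebra.norm_le_one_iff_of_nonneg T hT0).2 hT1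
    rw [tendsto_iff_norm_sub_tendsto_zero]
    -- The resolvent identity gives `Y x - R x = -ε R (Y x)`, of norm at most `ε ‖x‖` since `R` and
    -- `Y` are contractions.
    refine squeeze_zero (fun _ => norm_nonneg _) (fun n => ?_)
      (g := fun n : ℕ => 1 / ((n : ℝ) + 1) * ‖x‖) ?_
    · obtain ⟨hn0, hn1, hn, -⟩ := hY _ (hε n)
      have h2 : Y (1 / ((n : ℝ) + 1)) x + ((1 / ((n : ℝ) + 1) : ℝ) : ℂ) •
          R (Y (1 / ((n : ℝ) + 1)) x) = R x := congrArg (fun T : H →L[ℂ] H => T x) hn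
      change ‖Y (1 / ((n : ℝ) + 1)) x - R x‖ ≤ _
      rw [← h2, sub_add_cancel_left, norm_neg, norm_smul, Complex.norm_real,
        Real.norm_of_nonneg (hε n)]
      gcongr
      exact (hnorm h0 h1 _).trans (hnorm hn0 (hn1.trans h1) x)
    · have := (tendsto_one_div_add_atTop_nhds_zero_nat (𝕜 := ℝ)).mul_const ‖x‖
      rwa [zero_mul] at this

theorem isStrongResolventLimit_parallelSum {A B : LinRel H} (hA : A.IsNonnegSelfAdjoint)
    (hB : B.IsNonnegSelfAdjoint) :
    IsStrongResolventLimit (fun n : ℕ => (A.addScalar (1 / ((n : ℝ) + 1))).parallelSum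
      (B.addScalar (1 / ((n : ℝ) + 1)))) (A.parallelSum B) := by
  obtain ⟨P, P', hP, hP', hP0, hP1, hPanti, hP0', hP1', hPP', hPlim⟩ :=
    exists_resolvent_inv_addScalar hA
  obtain ⟨Q, Q', hQ, hQ', hQ0, hQ1, hQanti, hQ0', hQ1', hQQ', hQlim⟩ :=
    exists_resolvent_inv_addScalar hB
  have hS (n : ℕ) := (isNonnegSelfAdjoint_ofResolvent (hP0 n) (hP1 n)).formSum
    (isNonnegSelfAdjoint_ofResolvent (hQ0 n) (hQ1 n))
  choose R hR0 hR1 hR using fun n => (hS n).exists_eq_ofResolvent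
  obtain ⟨R', hR0', hR1', hR'⟩ := ((isNonnegSelfAdjoint_ofResolvent hP0' hP1').formSum
    (isNonnegSelfAdjoint_ofResolvent hQ0' hQ1')).exists_eq_ofResolvent
  have hlim := tendsto_formSum hP0 hP1 hPanti hP0' hP1' hPP' hPlim hQ0 hQ1 hQanti hQ0' hQ1' hQQ'
    hQlim hR0 hR1 hR0' hR1' hR hR'
  have e (n : ℕ) : (A.addScalar (1 / ((n : ℝ) + 1))).parallelSum
      (B.addScalar (1 / ((n : ℝ) + 1))) = ofResolvent (1 - R n) := by
    rw [parallelSum, hP, hQ, hR, inv_ofResolvent]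
  have e' : A.parallelSum B = ofResolvent (1 - R') := by
    rw [parallelSum, hP', hQ', hR', inv_ofResolvent]
  refine ⟨fun n => ?_, hA.parallelSum hB, fun n => 1 - R n, 1 - R', fun n => ?_, ?_, fun f => ?_⟩
  · change (parallelSum _ _).IsNonnegSelfAdjoint
    rw [e]
    exact isNonnegSelfAdjoint_ofResolvent (sub_nonneg.2 (hR1 n)) (sub_le_self _ (hR0 n))
  · exact (congrArg (fun T => (addScalar T 1).inv) (e n)).trans (inv_addScalar_one_ofResolvent _)
  · rw [e', inv_addScalar_one_ofResolvent]
  · exact tendsto_const_nhds.sub (hlim f)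

theorem parallelSum_addScalar_eq {A B : LinRel H} (hA : A.IsNonnegSelfAdjoint)
    (hB : B.IsNonnegSelfAdjoint) (n : ℕ) :
    ((A.addScalar (1 / ((n : ℝ) + 1))).inv.add (B.addScalar (1 / ((n : ℝ) + 1))).inv).inv =
      (A.addScalar (1 / ((n : ℝ) + 1))).parallelSum (B.addScalar (1 / ((n : ℝ) + 1))) := by
  have hε : (0 : ℝ) < 1 / ((n : ℝ) + 1) := by positivity
  obtain ⟨P, -, hP, -, hP0, hP1, -⟩ := exists_resolvent_inv_addScalar hA
  obtain ⟨Q, -, hQ, -, hQ0, hQ1, -⟩ := exists_resolvent_inv_addScalar hB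
  rw [parallelSum, add_eq_formSum (hP n ▸ isNonnegSelfAdjoint_ofResolvent (hP0 n) (hP1 n))
    (hQ n ▸ isNonnegSelfAdjoint_ofResolvent (hQ0 n) (hQ1 n))
    (exists_mem_inv_addScalar hA hε) (exists_mem_inv_addScalar hB hε)]

end LinRel

theorem theorem4p2 {H : Type*} [NormedAddCommGroup H] [InnerProductSpace ℂ H] [CompleteSpace H]
    (A B C : LinRel H) (hA : A.IsNonnegSelfAdjoint) (hB : B.IsNonnegSelfAdjoint)
    (hC : C.IsNonnegSelfAdjoint) :
    -- the parallel sum is again a nonnegative selfadjoint relation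
    (A.parallelSum B).IsNonnegSelfAdjoint ∧
    -- homogeneity
    (∀ r : ℝ, 0 < r → (A.scale r).parallelSum (B.scale r) = (A.parallelSum B).scale r) ∧
    -- commutativity
    A.parallelSum B = B.parallelSum A ∧
    -- associativity
    (A.parallelSum B).parallelSum C = A.parallelSum (B.parallelSum C) ∧
    A.parallelSum (B.parallelSum C) = (A.inv.formSum₃ B.inv C.inv).inv ∧
    -- upper bounds
    (A.parallelSum B).FormLE A ∧ (A.parallelSum B).FormLE B ∧
    -- monotonicity
    (∀ A₁ A₂ : LinRel H, A₁.IsNonnegSelfAdjoint → A₂.IsNonnegSelfAdjoint → A₁.FormLE A₂ →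
      (A₁.parallelSum B).FormLE (A₂.parallelSum B)) ∧
    -- range of the square root
    (A.parallelSum B).sqrt.ran = A.sqrt.ran ⊓ B.sqrt.ran ∧
    -- vanishing
    (A.parallelSum B = LinRel.zeroRel ↔ A.sqrt.ran ⊓ B.sqrt.ran = ⊥) ∧
    -- harmonic mean when the form of `A⁻¹` is a restriction of the form of `B⁻¹`
    (A.inv.form.IsRestrictionOf B.inv.form → A.harmonicMean B = A) ∧
    -- approximation, with `1 / (n + 1)` for `n = 0, 1, 2, …`
    LinRel.IsStrongResolventLimit
      (fun n : ℕ => (A.addScalar (1 / ((n : ℝ) + 1))).parallelSum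
        (B.addScalar (1 / ((n : ℝ) + 1)))) (A.parallelSum B) ∧
    LinRel.IsStrongResolventLimit
      (fun n : ℕ => ((A.addScalar (1 / ((n : ℝ) + 1))).inv.add
        (B.addScalar (1 / ((n : ℝ) + 1))).inv).inv) (A.parallelSum B) := by

  have hAB := hA.parallelSum hB
  refine ⟨hAB, fun r hr => LinRel.parallelSum_scale hA hB hr, LinRel.parallelSum_comm A B, ?_, ?_,
    LinRel.parallelSum_formLE_left hA hB, ?_,
    fun A₁ A₂ h₁ h₂ h => h.parallelSum h₁ h₂ hB, LinRel.ran_sqrt_parallelSum hA hB, ?_,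
    LinRel.harmonicMean_eq_left hA, LinRel.isStrongResolventLimit_parallelSum hA hB, ?_⟩
  · exact congrArg LinRel.inv (LinRel.formSum_assoc hA.inv hB.inv hC.inv)
  · rw [← LinRel.formSum_formSum hA.inv hB.inv, LinRel.formSum_assoc hA.inv hB.inv hC.inv]
    rfl
  · rw [LinRel.parallelSum_comm]
    exact LinRel.parallelSum_formLE_left hB hA
  · rw [hAB.eq_zeroRel_iff, LinRel.ran_sqrt_parallelSum hA hB]
  · simp only [LinRel.parallelSum_addScalar_eq hA hB]
    exact LinRel.isStrongResolventLimit_parallelSum hA hB
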